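/- **Setting.** A *Morse presentation* of a tangle diagram $T$ is a finite stack of Morse layers, numbered $1,\dots,n$ from bottom to top, each consisting of one crossing, one cap $\cap$ or one cup $\cup$ together with vertical bars on both sides, such that the numbers of strings of consecutive layers fit together ($n=0$ is allowed). $T$ is oriented, with $n_+$ positive and $n_-$ negative crossings. At a crossing which is negative when both strands point upwards, the $0$-smoothing is $\asymp$ and the $1$-smoothing is $)($; at the other kind of crossing it is the other way round. The Bar-Natan complex $[\![T]\!]$ is the hypercube of all smoothings of $T$. Its objects are crossingless diagrams, and its morphisms are degree $0$ formal $\mathbb Z$-linear sums of dotted cobordisms modulo: sphere $=0$, sphere with one dot $=1$, two dots on a component $=0$, and neck-cutting. A smoothing with $k$ $1$-smoothings has homological degree $k-n_-$ and quantum shift $k+n_+-2n_-$. If $c_1$ arises from $c_0$ by changing one $0$-smoothing, in layer $i$, to a $1$-smoothing, then the matrix element $c_0\to c_1$ of the differential $d$ is the saddle with sign $(-1)^r$, where $r$ is the number of $1$-smoothings of $c_0$ in layers below $i$; all other matrix elements are $0$. The delooping isomorphism $\Psi_c\colon c\{m\}\to\bigoplus_{K\subset L_c}c'\{m+2\#K-\#L_c\}$,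 where $L_c$ is the set of loops of $c$ and $c'$ is $c$ without its loops, has as its component at $K$ the vertical strips on the arcs together with a disc on each loop, dotted exactly on the loops in $K$; its inverse uses discs which are dotted exactly on the loops not in $K$. Put $\Psi T=(\Psi[\![T]\!],\Psi d\Psi^{-1})$. The basis elements (*cells*) of $\Psi T$ are the pairs of a smoothing and a set $K$ of its loops; the loops in $K$ are called red, the others blue. Let $G$ be the directed graph whose vertices are the cells and whose edges $a\to b$ are the non-zero matrix elements of the differential. For a loop $l$, let $\max(l)$ be the number of the highest Morse layer that contains a piece of $l$. For an edge $a\to b$ let $i(a\to b)$ be the number of the layer whose smoothing changes. For an edge $a\to b$ that is an isomorphism let $u(a\to b)$ be the minimum of $\max(l)$ over all red loops $l$ of $a$ that are merged by the saddle and all blue loops $l$ of $b$ that are split out by the saddle. Let $A_{j,k}$ be the set of the isomorphism edges with $i=j$ and $u=k$. Define recursively, for $j\ge 1$, $$N_j=\{(a\to b)\in A_{j,j}\mid a,b\text{ are not matched in any }N_l\text{ with }1\le l<j\},\qquad M_{\mathrm{lex}}=\bigcup_{j\ge1}N_j .$$ **Proposition.** For every Morse presentation of a tangle diagram $T$, the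 lexicographic matching $M_{\mathrm{lex}}$ is a Morse matching on $\Psi T$. That is: $M_{\mathrm{lex}}$ is a finite set of edges of $G$; distinct edges of $M_{\mathrm{lex}}$ have no common vertex; for every edge in $M_{\mathrm{lex}}$ the matrix element is an isomorphism; and the graph obtained from $G$ by reversing the edges in $M_{\mathrm{lex}}$ has no directed cycles. -/

import Mathlib

namespace TangleMorse

/-! ## Dotted cobordisms -/

/-- A compact 1-manifold with endpoints labelled by `P`, up to homeomorphism fixing the endpoints:
its finite set of connected components, and the component on which each endpoint lies.
It stands for a crossingless planar diagram; the components without endpoints are the loops.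
The diagrams used below are smoothed Morse presentations, with or without their loops. -/
structure Diagram (P : Type) where
  Comp : Type
  [fin : Finite Comp]
  bd : P → Comp

attribute [instance] Diagram.fin

namespace Diagram

variable {P : Type}

/-- A component is an arc if it has an endpoint. -/
def IsArc (c : Diagram P) (x : c.Comp) : Prop := ∃ p, c.bd p = x

/-- The loops, that is, the closed components. -/
abbrev Loop (c : Diagram P) : Type := {x : c.Comp // ¬ c.IsArc x}

open Classical in
/-- Euler characteristic of a component: `1` for an arc, `0` for a loop. -/
noncomputable def euler (c : Diagram P) (x : c.Comp) : ℤ := if c.IsArc x then 1 else 0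

/-- The diagram with all loops removed. -/
def deloop (c : Diagram P) : Diagram P where
  Comp := {x : c.Comp // c.IsArc x}
  bd p := ⟨c.bd p, p, rfl⟩

/-- The circles of the closed 1-manifold `c ∪ (P × [0,1]) ∪ c'`, which is the boundary of any
cobordism from `c` to `c'`. -/
def Circle (c c' : Diagram P) : Type :=
  Quot fun x y : c.Comp ⊕ c'.Comp => ∃ p, x = Sum.inl (c.bd p) ∧ y = Sum.inr (c'.bd p)

end Diagram

/-- A dotted cobordism from `c` to `c'`: a compact orientable surface with boundary
`c ∪ (P × [0,1]) ∪ c'`, with finitely many dots. By the classification of surfaces it is given,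
up to homeomorphism fixing the boundary and moving the dots within their components, by its
components, the component on which each piece of the boundary lies, and the genus and number of
dots of each component. -/
structure Surface {P : Type} (c c' : Diagram P) where
  Comp : Type
  [fin : Finite Comp]
  src : c.Comp → Comp
  tgt : c'.Comp → Comp
  compat : ∀ p, src (c.bd p) = tgt (c'.bd p)
  genus : Comp → ℕ
  dots : Comp → ℕ

attribute [instance] Surface.fin

namespace Surface

variable {P : Type} {c c' c'' : Diagram P}

/-- The component on which a boundary circle lies. -/
def ofCircle (F : Surface c c') : Diagram.Circle c c' → F.Comp :=
  Quot.lift (Sum.elim F.src F.tgt) (by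
    rintro _ _ ⟨p, rfl, rfl⟩
    exact F.compat p)

/-- The number of boundary circles of a component. -/
noncomputable def circles (F : Surface c c') (s : F.Comp) : ℕ :=
  Nat.card {q : Diagram.Circle c c' // F.ofCircle q = s}

/-- Euler characteristic of a component: `2 - 2 g - b`. -/
noncomputable def euler (F : Surface c c') (s : F.Comp) : ℤ :=
  2 - 2 * (F.genus s : ℤ) - (F.circles s : ℤ)

/-- Homeomorphism of dotted surfaces fixing the boundary. -/
def Homeo (F G : Surface c c') : Prop :=
  ∃ e : F.Comp ≃ G.Comp, (∀ x, e (F.src x) = G.src x) ∧ (∀ x, e (F.tgt x) = G.tgt x) ∧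
    (∀ s, G.genus (e s) = F.genus s) ∧ (∀ s, G.dots (e s) = F.dots s)

/-- The cylinder `c × [0,1]`. -/
def id (c : Diagram P) : Surface c c where
  Comp := c.Comp
  src x := x
  tgt x := x
  compat _ := rfl
  genus _ := 0
  dots _ := 0

/-- The components of the surface obtained by gluing `F` and `G` along `c'`. -/
def GlueComp (F : Surface c c') (G : Surface c' c'') : Type :=
  Quot fun s t : F.Comp ⊕ G.Comp => ∃ x, s = Sum.inl (F.tgt x) ∧ t = Sum.inr (G.src x)

instance (F : Surface c c') (G : Surface c' c'') : Finite (GlueComp F G) :=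
  inferInstanceAs (Finite (Quot _))

/-- Euler characteristic of a component of the glued surface,
`χ(F ∪ G) = χ(F) + χ(G) - χ(c')` restricted to that component. -/
noncomputable def glueEuler (F : Surface c c') (G : Surface c' c'') (q : GlueComp F G) : ℤ :=
  (∑ᶠ s : {s : F.Comp // Quot.mk _ (Sum.inl s) = q}, F.euler s.1)
    + (∑ᶠ t : {t : G.Comp // Quot.mk _ (Sum.inr t) = q}, G.euler t.1)
    - ∑ᶠ x : {x : c'.Comp // Quot.mk _ (Sum.inl (F.tgt x)) = q}, c'.euler x.1

/-- The glued surface, before its genus is known. -/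
noncomputable def preComp (F : Surface c c') (G : Surface c' c'') : Surface c c'' where
  Comp := GlueComp F G
  src x := Quot.mk _ (Sum.inl (F.src x))
  tgt x := Quot.mk _ (Sum.inr (G.tgt x))
  compat p := by
    rw [F.compat p, ← G.compat p]
    exact Quot.sound ⟨c'.bd p, rfl, rfl⟩
  genus _ := 0
  dots q := (∑ᶠ s : {s : F.Comp // Quot.mk _ (Sum.inl s) = q}, F.dots s.1)
    + ∑ᶠ t : {t : G.Comp // Quot.mk _ (Sum.inr t) = q}, G.dots t.1

/-- Composition of cobordisms: gluing along `c'`. The genus `g` of a component with Euler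
characteristic `χ` and `b` boundary circles is found from `χ = 2 - 2 g - b`. -/
noncomputable def comp (F : Surface c c') (G : Surface c' c'') : Surface c c'' :=
  { preComp F G with
    genus := fun q => ((2 - ((preComp F G).circles q : ℤ) - glueEuler F G q) / 2).toNat }

/-- The disjoint union of `F` with a sphere carrying `n` dots. -/
def addSphere (F : Surface c c') (n : ℕ) : Surface c c' where
  Comp := Option F.Comp
  src x := some (F.src x)
  tgt x := some (F.tgt x)
  compat p := congrArg some (F.compat p)
  genus s := s.elim 0 F.genus
  dots s := s.elim n F.dots

open Classical in
/-- One more dot on the component `s`. -/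
noncomputable def addDot (F : Surface c c') (s : F.Comp) : Surface c c' :=
  { F with dots := fun t => F.dots t + if t = s then 1 else 0 }

open Classical in
/-- The surface obtained from `F` by adding a tube (neck) from the component `s` to the
component `t`; if `s = t`, this adds a handle. -/
noncomputable def tube (F : Surface c c') (s t : F.Comp) : Surface c c' where
  Comp := Quot fun x y : F.Comp => x = s ∧ y = t
  src x := Quot.mk _ (F.src x)
  tgt x := Quot.mk _ (F.tgt x)
  compat p := congrArg (Quot.mk _) (F.compat p)
  genus q := (∑ᶠ x : {x : F.Comp // Quot.mk _ x = q}, F.genus x.1)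
    + if s = t ∧ Quot.mk _ s = q then 1 else 0
  dots q := ∑ᶠ x : {x : F.Comp // Quot.mk _ x = q}, F.dots x.1

/-- The degree of `F`, as a morphism `c{m} → c'{m'}`: `χ - 2 # dots - n + m' - m`, where `n`, half
the number of endpoints, is the number of arcs of `c`. -/
noncomputable def degree (F : Surface c c') (m m' : ℤ) : ℤ :=
  (∑ᶠ s, F.euler s) - 2 * ((∑ᶠ s, F.dots s : ℕ) : ℤ) - (Nat.card {x // c.IsArc x} : ℤ) + m' - m

/-- The cobordism `c → c'` from a diagram to the diagram without its loops: vertical strips on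
the arcs, and a disc on each loop, dotted if the loop is in `red`. -/
noncomputable def deloopHom (c : Diagram P) (red : Set c.Loop) : Surface c c.deloop where
  Comp := c.Comp
  src x := x
  tgt x := x.1
  compat _ := rfl
  genus _ := 0
  dots x := Set.indicator (Subtype.val '' red) (fun _ => 1) x

/-- The cobordism `c' → c` from the diagram without loops: vertical strips on
the arcs, and a disc on each loop, dotted if the loop is not in `red`. -/
noncomputable def deloopInv (c : Diagram P) (red : Set c.Loop) : Surface c.deloop c where
  Comp := c.Comp
  src x := x.1
  tgt x := x
  compat _ := rfl
  genus _ := 0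
  dots x := Set.indicator (Subtype.val '' redᶜ) (fun _ => 1) x

end Surface

/-- Formal sums of dotted cobordisms from `c` to `c'`. Morphisms of the dotted cobordism category
are such sums modulo `Mor.rel`. -/
abbrev Mor {P : Type} (c c' : Diagram P) : Type 1 := Surface c c' →₀ ℤ

namespace Mor

variable {P : Type} {c c' c'' : Diagram P}

/-- Bilinear extension of the composition of cobordisms. -/
noncomputable def comp (f : Mor c c') (g : Mor c' c'') : Mor c c'' :=
  f.sum fun F m => g.sum fun G n => Finsupp.single (F.comp G) (m * n)

/-- The class of a single cobordism. -/
noncomputable def of (F : Surface c c') : Mor c c' := Finsupp.single F 1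

/-- The relations: homeomorphic surfaces are equal; an undotted sphere is `0`; a sphere with one
dot is `1`; two dots on a component are `0`; a neck is the sum of the two ways of cutting it
and putting a dot on one of the two sides. -/
inductive IsRelator : Mor c c' → Prop
  | homeo (F G : Surface c c') : F.Homeo G → IsRelator (of F - of G)
  | sphere (F : Surface c c') : IsRelator (of (F.addSphere 0))
  | dottedSphere (F : Surface c c') : IsRelator (of (F.addSphere 1) - of F)
  | twoDots (F : Surface c c') (s : F.Comp) : IsRelator (of ((F.addDot s).addDot s))
  | neck (F : Surface c c') (s t : F.Comp) :
      IsRelator (of (F.tube s t) - (of (F.addDot s) + of (F.addDot t)))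

/-- The subgroup of the formal sums that represent the zero morphism. -/
noncomputable def rel (c c' : Diagram P) : AddSubgroup (Mor c c') := AddSubgroup.closure {f | IsRelator f}

/-- `f` has degree `0` as a morphism `c{m} → c'{m'}`. -/
def DegreeZero (f : Mor c c') (m m' : ℤ) : Prop := ∀ F ∈ f.support, F.degree m m' = 0

/-- `f : c{m} → c'{m'}` is an isomorphism in the category of graded diagrams and degree `0`
sums of dotted cobordisms modulo the relations. -/
def IsIso (f : Mor c c') (m m' : ℤ) : Prop :=
  f.DegreeZero m m' ∧ ∃ g : Mor c' c, g.DegreeZero m' m ∧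
    comp f g - of (Surface.id c) ∈ rel c c ∧ comp g f - of (Surface.id c') ∈ rel c' c'

end Mor

/-! ## Morse presentations -/

/-- The non-trivial part of a Morse layer: one of the two crossings (`pos` and `neg` are the
positive and the negative crossing if both strands are oriented upwards), a cap `∩`
or a cup `∪`. -/
inductive Layer
  | pos
  | neg
  | cap
  | cup
  deriving DecidableEq

/-- A layer with `p` vertical bars to the left has `m` strings at the bottom and `n` at the top. -/
def Layer.Fits (p m n : ℕ) : Layer → Prop
  | .pos => p + 2 ≤ m ∧ n = m
  | .neg => p + 2 ≤ m ∧ n = m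
  | .cap => p + 2 ≤ m ∧ n + 2 = m
  | .cup => p ≤ m ∧ n = m + 2

/-- In a layer with `p` bars to the left, the strand at position `x` at the bottom runs to
position `y` at the top. -/
def Layer.Through (p x y : ℕ) : Layer → Prop
  | .pos => y = Equiv.swap p (p + 1) x
  | .neg => y = Equiv.swap p (p + 1) x
  | .cap => (x < p ∧ y = x) ∨ (p + 2 ≤ x ∧ y + 2 = x)
  | .cup => (x < p ∧ y = x) ∨ (p ≤ x ∧ y = x + 2)

/-- The non-trivial part of a crossingless layer: two vertical strands `)(`, or a cap below
a cup, or only a cap, or only a cup. -/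
inductive Flat
  | vert
  | horiz
  | cap
  | cup

/-- The positions `x`, `y` at the bottom are joined by a cap. -/
def Flat.Bottom (p x y : ℕ) : Flat → Prop
  | .vert => False
  | .horiz => x = p ∧ y = p + 1
  | .cap => x = p ∧ y = p + 1
  | .cup => False

/-- The positions `x`, `y` at the top are joined by a cup. -/
def Flat.Top (p x y : ℕ) : Flat → Prop
  | .vert => False
  | .horiz => x = p ∧ y = p + 1
  | .cap => False
  | .cup => x = p ∧ y = p + 1

/-- The position `x` at the bottom is joined to the position `y` at the top. -/
def Flat.Through (p x y : ℕ) : Flat → Prop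
  | .vert => y = x
  | .horiz => y = x ∧ (x < p ∨ p + 2 ≤ x)
  | .cap => (x < p ∧ y = x) ∨ (p + 2 ≤ x ∧ y + 2 = x)
  | .cup => (x < p ∧ y = x) ∨ (p ≤ x ∧ y = x + 2)

/-- A Morse presentation of a tangle diagram: Morse layers, numbered from the bottom to the top,
with the number `width h` of strings at each height `h`, and the number `bars j` of vertical bars
to the left of the non-trivial part of layer `j`. The `j`-th layer (counted from `0`) lies between
the heights `j` and `j + 1`. -/
structure MorsePresentation where
  len : ℕ
  width : Fin (len + 1) → ℕ
  layer : Fin len → Layer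
  bars : Fin len → ℕ
  fits : ∀ j, (layer j).Fits (bars j) (width j.castSucc) (width j.succ)

namespace MorsePresentation

variable (T : MorsePresentation)

/-- The points in which the strings meet the horizontal lines between the layers. -/
abbrev Node : Type := (h : Fin (T.len + 1)) × Fin (T.width h)

/-- The endpoints of the tangle, at the bottom and at the top. -/
abbrev Endpoint : Type := Fin (T.width 0) ⊕ Fin (T.width (Fin.last T.len))

/-- The endpoints as nodes. -/
def endNode : T.Endpoint → T.Node := Sum.elim (fun x => ⟨0, x⟩) (fun x => ⟨Fin.last T.len, x⟩)

/-- The crossings. -/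
abbrev Crossing : Type := {j : Fin T.len // T.layer j = .pos ∨ T.layer j = .neg}

/-- An orientation of the tangle: at every node, whether the string is directed upwards. -/
structure Orientation where
  up : T.Node → Bool
  through : ∀ j x y, (T.layer j).Through (T.bars j) x.1 y.1 →
    up ⟨j.castSucc, x⟩ = up ⟨j.succ, y⟩
  cap : ∀ (j : Fin T.len) (x y : Fin (T.width j.castSucc)), T.layer j = .cap →
    x.1 = T.bars j → y.1 = T.bars j + 1 → up ⟨j.castSucc, x⟩ ≠ up ⟨j.castSucc, y⟩
  cup : ∀ (j : Fin T.len) (x y : Fin (T.width j.succ)), T.layer j = .cup →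
    x.1 = T.bars j → y.1 = T.bars j + 1 → up ⟨j.succ, x⟩ ≠ up ⟨j.succ, y⟩

variable {T}

/-- A crossing is positive if it is of shape `pos` and its strands are both directed upwards or
both downwards, or if it is of shape `neg` and just one of them is directed upwards. -/
def Orientation.IsPositive (o : T.Orientation) (j : T.Crossing) : Prop :=
  ∃ x y : Fin (T.width j.1.castSucc), x.1 = T.bars j.1 ∧ y.1 = T.bars j.1 + 1 ∧
    (o.up ⟨j.1.castSucc, x⟩ = o.up ⟨j.1.castSucc, y⟩ ↔ T.layer j.1 = .pos)

/-- The number of positive crossings. -/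
noncomputable def Orientation.nPlus (o : T.Orientation) : ℕ :=
  Nat.card {j : T.Crossing // o.IsPositive j}

/-- The number of negative crossings. -/
noncomputable def Orientation.nMinus (o : T.Orientation) : ℕ :=
  Nat.card {j : T.Crossing // ¬ o.IsPositive j}

variable (T)

/-- A choice of a `0`- or `1`-smoothing at each crossing. -/
abbrev Smoothing : Type := T.Crossing → Fin 2

variable {T}

namespace Smoothing

variable (s : T.Smoothing)

/-- The layers of the smoothed diagram. The `0`-smoothing of `neg` and the `1`-smoothing of `pos`
are horizontal, the other two are vertical. -/
def flat (j : Fin T.len) : Flat :=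
  if h : T.layer j = .pos then (if s ⟨j, Or.inl h⟩ = 0 then .vert else .horiz)
  else if h : T.layer j = .neg then (if s ⟨j, Or.inr h⟩ = 0 then .horiz else .vert)
  else if T.layer j = .cap then .cap
  else .cup

/-- Two nodes are joined by a segment of the smoothed diagram within some layer. -/
inductive Joined : T.Node → T.Node → Prop
  | bottom (j : Fin T.len) (x y : Fin (T.width j.castSucc)) :
      (s.flat j).Bottom (T.bars j) x.1 y.1 → Joined ⟨j.castSucc, x⟩ ⟨j.castSucc, y⟩
  | top (j : Fin T.len) (x y : Fin (T.width j.succ)) :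
      (s.flat j).Top (T.bars j) x.1 y.1 → Joined ⟨j.succ, x⟩ ⟨j.succ, y⟩
  | through (j : Fin T.len) (x : Fin (T.width j.castSucc)) (y : Fin (T.width j.succ)) :
      (s.flat j).Through (T.bars j) x.1 y.1 → Joined ⟨j.castSucc, x⟩ ⟨j.succ, y⟩

/-- The smoothed diagram. -/
def diagram : Diagram T.Endpoint where
  Comp := Quot s.Joined
  bd p := Quot.mk _ (T.endNode p)

/-- The number of `1`-smoothings. -/
noncomputable def ones : ℕ := Nat.card {j : T.Crossing // s j = 1}

/-- For smoothings that differ in one crossing, the saddle cobordism between the smoothed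
diagrams: the cylinder outside the crossing, and a saddle at the crossing. The saddle connects the
four nodes around the crossing, and all components have genus `0`. -/
def saddle (s s' : T.Smoothing) : Surface s.diagram s'.diagram where
  Comp := Quot fun x y : T.Node => s.Joined x y ∨ s'.Joined x y
  src := Quot.map (fun x => x) fun _ _ h => Or.inl h
  tgt := Quot.map (fun x => x) fun _ _ h => Or.inr h
  compat _ := rfl
  genus _ := 0
  dots _ := 0

/-- `s'` arises from `s` by changing the `0`-smoothing at `j` to the `1`-smoothing. -/
def Changes (s s' : T.Smoothing) (j : T.Crossing) : Prop :=
  s j = 0 ∧ s' j = 1 ∧ ∀ k, k ≠ j → s' k = s k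

open Classical in
/-- The matrix element `s → s'` of the hypercube complex: if `s'` arises from `s` by a change at
`j`, the saddle with the sign `(-1) ^ #{k < j | s k = 1}`, and otherwise `0`. -/
noncomputable def d (s s' : T.Smoothing) : Mor s.diagram s'.diagram :=
  ∑ j : T.Crossing, if s.Changes s' j then
    Finsupp.single (saddle s s') ((-1) ^ Nat.card {k : T.Crossing // k.1 < j.1 ∧ s k = 1})
  else 0

/-- The number (counted from `1`) of the highest layer that contains a piece of the loop `l`. -/
noncomputable def maxLayer (l : s.diagram.Loop) : ℕ :=
  sSup {k | ∃ (j : Fin T.len) (x : T.Node), k = j.1 + 1 ∧ (x.1 = j.castSucc ∨ x.1 = j.succ) ∧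
    (Quot.mk _ x : Quot s.Joined) = l.1}

end Smoothing

/-! ## The delooped complex -/

variable (T)

/-- A cell of the delooped complex: a smoothing with a set of its loops, coloured red; the other
loops are blue. -/
structure Cell where
  smoothing : T.Smoothing
  red : Set smoothing.diagram.Loop

variable {T}

namespace Cell

/-- The diagram underlying the summand: the smoothed diagram without its loops. -/
abbrev obj (a : T.Cell) : Diagram T.Endpoint := a.smoothing.diagram.deloop

/-- Homological degree. -/
noncomputable def homDegree (o : T.Orientation) (a : T.Cell) : ℤ := a.smoothing.ones - o.nMinus

/-- Quantum degree shift. -/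
noncomputable def shift (o : T.Orientation) (a : T.Cell) : ℤ :=
  a.smoothing.ones + o.nPlus - 2 * o.nMinus
    + 2 * (a.red.ncard : ℤ) - (Nat.card a.smoothing.diagram.Loop : ℤ)

/-- The matrix element `a → b` of `Ψ d Ψ⁻¹`. -/
noncomputable def d (a b : T.Cell) : Mor a.obj b.obj :=
  ((Mor.of (Surface.deloopInv a.smoothing.diagram a.red)).comp
    (Smoothing.d a.smoothing b.smoothing)).comp
      (Mor.of (Surface.deloopHom b.smoothing.diagram b.red))

/-- The matrix element `a → b` is an isomorphism. -/
def IsIso (o : T.Orientation) (a b : T.Cell) : Prop := (d a b).IsIso (a.shift o) (b.shift o)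

/-- The number (counted from `1`) of the layer at which `a → b` changes a smoothing from
`0` to `1`. -/
noncomputable def i (a b : T.Cell) : ℕ :=
  sInf {k | ∃ j : T.Crossing, a.smoothing.Changes b.smoothing j ∧ k = j.1.1 + 1}

/-- The loop `l` of `a` is merged with another component of `a` by the saddle `a → b`. -/
def Merged (a b : T.Cell) (l : a.smoothing.diagram.Loop) : Prop :=
  ∃ x : a.smoothing.diagram.Comp, x ≠ l.1 ∧
    (Smoothing.saddle a.smoothing b.smoothing).src x =
      (Smoothing.saddle a.smoothing b.smoothing).src l.1

/-- The loop `l` of `b` is split from another component of `b` by the saddle `a → b`. -/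
def SplitOut (a b : T.Cell) (l : b.smoothing.diagram.Loop) : Prop :=
  ∃ x : b.smoothing.diagram.Comp, x ≠ l.1 ∧
    (Smoothing.saddle a.smoothing b.smoothing).tgt x =
      (Smoothing.saddle a.smoothing b.smoothing).tgt l.1

/-- The minimum of `maxLayer l` over the red loops `l` of `a` that are merged by `a → b` and the
blue loops `l` of `b` that are split out by `a → b`. If there is no such loop, the value is `0`,
which is not the number of a layer. -/
noncomputable def u (a b : T.Cell) : ℕ :=
  sInf ({k | ∃ l ∈ a.red, Merged a b l ∧ k = a.smoothing.maxLayer l} ∪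
    {k | ∃ l ∉ b.red, SplitOut a b l ∧ k = b.smoothing.maxLayer l})

end Cell

/-- The directed graph of the delooped complex: its vertices are the cells, its edges the non-zero
matrix elements. -/
def graph (o : T.Orientation) : Digraph T.Cell where
  Adj a b := b.homDegree o = a.homDegree o + 1 ∧ Cell.d a b ∉ Mor.rel a.obj b.obj

end MorsePresentation

/-! ## Morse matchings -/

section Matching

variable {V : Type*}

/-- Two edges are adjacent if they have a common vertex. -/
def Adjacent (e f : V × V) : Prop := e.1 = f.1 ∨ e.1 = f.2 ∨ e.2 = f.1 ∨ e.2 = f.2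

/-- The graph with the edges in `M` reversed. -/
def reverseEdges (G : Digraph V) (M : Set (V × V)) : Digraph V where
  Adj a b := (G.Adj a b ∧ (a, b) ∉ M) ∨ (b, a) ∈ M

/-- `M` is a Morse matching on the graph `G` of a based complex, where `iso a b` says that
the matrix element `a → b` is an isomorphism. -/
structure IsMorseMatching (G : Digraph V) (iso : V → V → Prop) (M : Set (V × V)) : Prop where
  edges : ∀ e ∈ M, G.Adj e.1 e.2
  finite : M.Finite
  matching : ∀ e ∈ M, ∀ f ∈ M, e ≠ f → ¬ Adjacent e f
  isIso : ∀ e ∈ M, iso e.1 e.2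
  acyclic : ∀ a, ¬ Relation.TransGen (reverseEdges G M).Adj a a

end Matching

namespace MorsePresentation

variable {T : MorsePresentation}

/-- The edges `a → b` that are isomorphisms with `i (a → b) = j` and `u (a → b) = k`. -/
def A (o : T.Orientation) (j k : ℕ) : Set (T.Cell × T.Cell) :=
  {e | (graph o).Adj e.1 e.2 ∧ Cell.IsIso o e.1 e.2 ∧ Cell.i e.1 e.2 = j ∧ Cell.u e.1 e.2 = k}

/-- The edges in `A j j` whose ends are not matched in any `N l` with `1 ≤ l < j`. -/
def N (o : T.Orientation) (j : ℕ) : Set (T.Cell × T.Cell) :=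
  {e | e ∈ A o j j ∧ ∀ l, 1 ≤ l → ∀ _h : l < j, ∀ f ∈ N o l, ¬ Adjacent e f}
termination_by j

/-- The lexicographic matching. -/
def lexMatching (o : T.Orientation) : Set (T.Cell × T.Cell) := {e | ∃ j, 1 ≤ j ∧ e ∈ N o j}

end MorsePresentation

end TangleMorse

/-! Up to sign, a matrix element of the delooped complex is one surface: the saddle with a disc
glued to every loop (`surface_homeo_capped`). Its components without endpoints are spheres, so if
the element is non-zero, each of them carries exactly one dot (`capped_dots_eq_one`). Everything
about colours follows from this count.

The edges with `i = u = j` have a purely geometric description, `IsKey`: the saddle at the crossing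
of layer `j` merges a red loop, or splits out a blue loop, that touches the crossing from below and
does not reach the top of the layer. Planarity enters through a parity count: such a loop meets each
horizontal line an even number of times, so the two lower nodes of the crossing are already joined
without the arc at the crossing (`IsPair.cls_bl_eq_cls_br`). Hence the saddle only joins the loop to
the component above it, and all other components persist. The disc on the loop carries no dot, so
what is left consists of undotted strips and spheres with one dot. Thus every non-zero key element
is an isomorphism (`IsKey.isIso`) and preserves all other colours (`IsKey.redAt_iff`). Therefore
either end of a key edge in a given layer determines the edge. This is the matching property within
one layer; conflicts between layers are excluded by the recursion.

For acyclicity, consider a closed walk and the lowest layer `j` in which it may change a crossing.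
Two successive reversed edges would share a vertex, so the walk alternates between two homological
degrees, and both ends of each forward edge in it are matched by edges of the walk
(`matched_of_closed`). None of these lies in a layer below `j`, so a forward key edge in layer `j`
would itself belong to `N j` (`mem_lexMatching_of_closed`). It is here that key edges must be known
to be isomorphisms. So each step in layer `j` is a forward non-key edge or a reversed key edge. Both
increase a three-valued `potential`, which steps in higher layers preserve because they do not meet
a low loop. A closed walk therefore avoids layer `j`, and by induction every layer. -/

namespace TangleMorse

/-! ## Gluing cobordisms along discs and cylinders -/

instance Diagram.finite_circle {P : Type} (c c' : Diagram P) : Finite (Diagram.Circle c c') :=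
  inferInstanceAs (Finite (Quot _))

/-- The circles of `c ∪ c'`, read upside down. -/
def Diagram.circleSwap {P : Type} (c c' : Diagram P) : Diagram.Circle c c' → Diagram.Circle c' c :=
  Quot.lift (fun x => Quot.mk _ x.swap) (by
    rintro _ _ ⟨p, rfl, rfl⟩
    exact (Quot.sound ⟨p, rfl, rfl⟩).symm)

theorem Diagram.circleSwap_circleSwap {P : Type} (c c' : Diagram P) (q : Diagram.Circle c c') :
    Diagram.circleSwap c' c (Diagram.circleSwap c c' q) = q := by
  induction q using Quot.ind with
  | _ x => cases x <;> rfl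

/-- `Diagram.circleSwap` as an equivalence. -/
def Diagram.circleEquivSwap {P : Type} (c c' : Diagram P) :
    Diagram.Circle c c' ≃ Diagram.Circle c' c where
  toFun := circleSwap c c'
  invFun := circleSwap c' c
  left_inv := circleSwap_circleSwap c c'
  right_inv := circleSwap_circleSwap c' c

namespace Surface

variable {P : Type} {c c' c'' : Diagram P}

theorem Homeo.symm {F G : Surface c c'} (h : F.Homeo G) : G.Homeo F := by
  obtain ⟨e, h1, h2, h3, h4⟩ := h
  refine ⟨e.symm, fun x => ?_, fun x => ?_, fun s => ?_, fun s => ?_⟩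
  · rw [← h1, e.symm_apply_apply]
  · rw [← h2, e.symm_apply_apply]
  · rw [← h3, e.apply_symm_apply]
  · rw [← h4, e.apply_symm_apply]

theorem Homeo.trans {F G H : Surface c c'} (h : F.Homeo G) (h' : G.Homeo H) : F.Homeo H := by
  obtain ⟨e, h1, h2, h3, h4⟩ := h
  obtain ⟨e', h1', h2', h3', h4'⟩ := h'
  exact ⟨e.trans e', fun x => by simp [h1, h1'], fun x => by simp [h2, h2'],
    fun x => by simp [h3, h3'], fun x => by simp [h4, h4']⟩

theorem Homeo.ofCircle {F G : Surface c c'} {e : F.Comp ≃ G.Comp}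
    (h1 : ∀ x, e (F.src x) = G.src x) (h2 : ∀ x, e (F.tgt x) = G.tgt x)
    (q : Diagram.Circle c c') : G.ofCircle q = e (F.ofCircle q) := by
  induction q using Quot.ind with
  | _ x =>
    cases x with
    | inl x => exact (h1 x).symm
    | inr x => exact (h2 x).symm

theorem Homeo.circles {F G : Surface c c'} {e : F.Comp ≃ G.Comp}
    (h1 : ∀ x, e (F.src x) = G.src x) (h2 : ∀ x, e (F.tgt x) = G.tgt x) (s : F.Comp) :
    G.circles (e s) = F.circles s := by
  refine Nat.card_congr (Equiv.subtypeEquivRight fun q => ?_)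
  rw [Homeo.ofCircle h1 h2, e.apply_eq_iff_eq]

/-- The cobordism turned upside down. -/
def flip (F : Surface c c') : Surface c' c where
  Comp := F.Comp
  src := F.tgt
  tgt := F.src
  compat p := (F.compat p).symm
  genus := F.genus
  dots := F.dots

theorem ofCircle_flip (F : Surface c c') (q : Diagram.Circle c c') :
    F.flip.ofCircle (Diagram.circleSwap c c' q) = F.ofCircle q := by
  induction q using Quot.ind with
  | _ x => cases x <;> rfl

theorem circles_flip (F : Surface c c') (s : F.Comp) : F.flip.circles s = F.circles s := by
  refine (Nat.card_congr ((Diagram.circleEquivSwap c c').subtypeEquiv fun q => ?_)).symm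
  rw [← ofCircle_flip]
  rfl

theorem euler_flip (F : Surface c c') (s : F.Comp) : F.flip.euler s = F.euler s :=
  congrArg (fun n : ℕ => 2 - 2 * (F.genus s : ℤ) - (n : ℤ)) (circles_flip F s)

theorem Homeo.flip {F G : Surface c c'} (h : F.Homeo G) : F.flip.Homeo G.flip := by
  obtain ⟨e, h1, h2, h3, h4⟩ := h
  exact ⟨e, h2, h1, h3, h4⟩

/-- The component of a composition that contains a component of the first factor. -/
def GlueComp.inl (F : Surface c c') (G : Surface c' c'') (s : F.Comp) : GlueComp F G :=
  Quot.mk _ (Sum.inl s)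

/-- The component of a composition that contains a component of the second factor. -/
def GlueComp.inr (F : Surface c c') (G : Surface c' c'') (s : G.Comp) : GlueComp F G :=
  Quot.mk _ (Sum.inr s)

theorem GlueComp.inl_tgt (F : Surface c c') (G : Surface c' c'') (x : c'.Comp) :
    GlueComp.inl F G (F.tgt x) = GlueComp.inr F G (G.src x) := Quot.sound ⟨x, rfl, rfl⟩

theorem GlueComp.ind {F : Surface c c'} {G : Surface c' c''} {p : GlueComp F G → Prop}
    (hl : ∀ s, p (GlueComp.inl F G s)) (hr : ∀ s, p (GlueComp.inr F G s)) (q : GlueComp F G) :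
    p q := by
  induction q using Quot.ind with
  | _ x =>
    cases x with
    | inl x => exact hl x
    | inr x => exact hr x

/-- Maps from the set of components of a composition. -/
def GlueComp.lift {F : Surface c c'} {G : Surface c' c''} {α : Type} (f : F.Comp → α)
    (g : G.Comp → α) (h : ∀ x, f (F.tgt x) = g (G.src x)) : GlueComp F G → α :=
  Quot.lift (Sum.elim f g) (by
    rintro _ _ ⟨x, rfl, rfl⟩
    exact h x)

/-- The genus of a component of a composition as a function of the number `b` of its boundary
circles and its Euler characteristic `χ`. -/
def genusOf (b : ℕ) (χ : ℤ) : ℕ := ((2 - (b : ℤ) - χ) / 2).toNat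

/-- The number of boundary circles of a component of a composition. -/
noncomputable def glueCircles (F : Surface c c') (G : Surface c' c'') (q : GlueComp F G) : ℕ :=
  (preComp F G).circles q

theorem glueEuler_eq (F : Surface c c') (G : Surface c' c'') (q : GlueComp F G) :
    glueEuler F G q = (∑ᶠ s : {s : F.Comp // GlueComp.inl F G s = q}, F.euler s.1)
    + (∑ᶠ t : {t : G.Comp // GlueComp.inr F G t = q}, G.euler t.1)
    - ∑ᶠ x : {x : c'.Comp // GlueComp.inl F G (F.tgt x) = q}, c'.euler x.1 := rfl

theorem comp_dots (F : Surface c c') (G : Surface c' c'') (q : GlueComp F G) :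
    (F.comp G).dots q = (∑ᶠ s : {s : F.Comp // GlueComp.inl F G s = q}, F.dots s.1)
    + ∑ᶠ t : {t : G.Comp // GlueComp.inr F G t = q}, G.dots t.1 := rfl

/-- The components of a composition, read upside down. -/
def glueEquivSwap (F : Surface c c') (G : Surface c' c'') :
    GlueComp F G ≃ GlueComp G.flip F.flip where
  toFun := GlueComp.lift (GlueComp.inr G.flip F.flip) (GlueComp.inl G.flip F.flip)
    fun x => (GlueComp.inl_tgt G.flip F.flip x).symm
  invFun := GlueComp.lift (GlueComp.inr F G) (GlueComp.inl F G)
    fun x => (GlueComp.inl_tgt F G x).symm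
  left_inv := GlueComp.ind (fun _ => rfl) fun _ => rfl
  right_inv := GlueComp.ind (fun _ => rfl) fun _ => rfl

theorem finsum_subtype_congr {α β : Type} {M : Type*} [AddCommMonoid M] {p : α → Prop}
    {p' : β → Prop} (e : α ≃ β) (h : ∀ x, p x ↔ p' (e x)) (f : α → M) (g : β → M)
    (hf : ∀ x, f x = g (e x)) : ∑ᶠ x : {x // p x}, f x = ∑ᶠ x : {x // p' x}, g x := by
  rw [← finsum_comp_equiv (e.subtypeEquiv h)]
  exact finsum_congr fun x => hf x

/-- Gluing is symmetric under reflection. This transfers the results on capping at the top to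
capping at the bottom. -/
theorem comp_flip (F : Surface c c') (G : Surface c' c'') :
    (F.comp G).flip.Homeo (G.flip.comp F.flip) := by
  have hl (q : GlueComp F G) (s : F.Comp) : GlueComp.inl F G s = q ↔
      GlueComp.inr G.flip F.flip s = glueEquivSwap F G q :=
    (glueEquivSwap F G).apply_eq_iff_eq.symm
  have hr (q : GlueComp F G) (s : G.Comp) : GlueComp.inr F G s = q ↔
      GlueComp.inl G.flip F.flip s = glueEquivSwap F G q :=
    (glueEquivSwap F G).apply_eq_iff_eq.symm
  have hc (q : GlueComp F G) (x : c'.Comp) : GlueComp.inl F G (F.tgt x) = q ↔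
      GlueComp.inl G.flip F.flip (G.flip.tgt x) = glueEquivSwap F G q := by
    rw [GlueComp.inl_tgt]
    exact hr q _
  have hE (q : GlueComp F G) : glueEuler G.flip F.flip (glueEquivSwap F G q) = glueEuler F G q := by
    rw [glueEuler_eq, glueEuler_eq, add_comm (finsum _)]
    congr 1
    · congr 1
      · exact (finsum_subtype_congr (Equiv.refl F.Comp) (hl q) _ _
          fun s => (euler_flip F s).symm).symm
      · exact (finsum_subtype_congr (Equiv.refl G.Comp) (hr q) _ _
          fun s => (euler_flip G s).symm).symm
    · exact (finsum_subtype_congr (Equiv.refl c'.Comp) (hc q) _ _ fun s => rfl).symm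
  have hC (q : GlueComp F G) : glueCircles G.flip F.flip (glueEquivSwap F G q)
      = glueCircles F G q :=
    (Homeo.circles (F := (preComp F G).flip) (G := preComp G.flip F.flip)
      (e := glueEquivSwap F G) (fun _ => rfl) (fun _ => rfl) q).trans (circles_flip (preComp F G) q)
  refine ⟨glueEquivSwap F G, fun _ => rfl, fun _ => rfl, fun q => ?_, fun q => ?_⟩
  · exact congrArg₂ genusOf (hC q) (hE q)
  · refine (comp_dots G.flip F.flip (glueEquivSwap F G q)).trans
      (Eq.trans ?_ (comp_dots F G q).symm)
    rw [add_comm]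
    congr 1
    · exact (finsum_subtype_congr (Equiv.refl F.Comp) (hl q) _ _ fun s => rfl).symm
    · exact (finsum_subtype_congr (Equiv.refl G.Comp) (hr q) _ _ fun s => rfl).symm

theorem card_fiber_eq_one {α β : Type*} {f : α → β} (hf : Function.Injective f) (a : α) :
    Nat.card {x // f x = f a} = 1 := by
  rw [Nat.card_eq_one_iff_unique]
  exact ⟨⟨fun x y => Subtype.ext (hf (x.2.trans y.2.symm))⟩, ⟨⟨a, rfl⟩⟩⟩

/-- The Euler characteristic of the cylinder over a component. -/
theorem circles_id (c : Diagram P) (x : c.Comp) :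
    ((Surface.id c).circles x : ℤ) = 2 - c.euler x := by
  classical
  by_cases h : c.IsArc x
  · rw [Diagram.euler, if_pos h]
    obtain ⟨p, rfl⟩ := h
    suffices (Surface.id c).circles (c.bd p) = 1 by rw [this]; norm_num
    refine Nat.card_eq_one_iff_unique.2 ⟨⟨?_⟩, ⟨⟨Quot.mk _ (Sum.inl (c.bd p)), rfl⟩⟩⟩
    have key : ∀ q : Diagram.Circle c c, (Surface.id c).ofCircle q = c.bd p →
        q = Quot.mk _ (Sum.inl (c.bd p)) := by
      intro q hq
      induction q using Quot.ind with
      | _ y =>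
        cases y with
        | inl y => exact congrArg (fun z => Quot.mk _ (Sum.inl z)) hq
        | inr y =>
          refine (congrArg (fun z => Quot.mk _ (Sum.inr z)) hq).trans ?_
          exact (Quot.sound ⟨p, rfl, rfl⟩).symm
    exact fun a b => Subtype.ext ((key _ a.2).trans (key _ b.2).symm)
  · rw [Diagram.euler, if_neg h]
    suffices (Surface.id c).circles x = 2 by rw [this]; norm_num
    -- On a loop, `isLeft` separates the two ends of the cylinder. The two ends of an arc are
    -- identified in `Circle`, so the value there must be constant; `false` is an arbitrary choice.
    let side : Diagram.Circle c c → Bool := Quot.lift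
      (fun y => if c.IsArc ((Sum.elim _root_.id _root_.id y : c.Comp)) then false else y.isLeft) (by
        rintro _ _ ⟨p, rfl, rfl⟩
        have : c.IsArc (c.bd p) := ⟨p, rfl⟩
        simp [this])
    refine Eq.trans (Nat.card_congr ⟨fun q => side q.1,
      fun b => ⟨Quot.mk _ (if b then Sum.inl x else Sum.inr x), by cases b <;> rfl⟩, ?_, ?_⟩) (Nat.card_eq_fintype_card (α := Bool) |>.trans Fintype.card_bool)
    · rintro ⟨q, hq⟩
      induction q using Quot.ind with
      | _ y =>
        cases y with
        | inl y => obtain rfl : y = x := hq; simp [side, h]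
        | inr y => obtain rfl : y = x := hq; simp [side, h]
    · intro b
      cases b <;> simp [side, h]

/-- If `c''` is glued to `c'` along an injection `ι` of components, the circles of `c ∪ c'` are
those of `c ∪ c''` and the components of `c'` which are not in the range of `ι`. -/
theorem card_circles_of_injection (F : Surface c c') (F' : Surface c c'') (e : F'.Comp ≃ F.Comp)
    (ι : c''.Comp → c'.Comp) (hι : Function.Injective ι) (hb : ∀ p, ι (c''.bd p) = c'.bd p)
    (h1 : ∀ x, e (F'.src x) = F.src x) (h2 : ∀ y, e (F'.tgt y) = F.tgt (ι y)) (s : F'.Comp) (t : F.Comp)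
    (ht : e s = t) :
    F.circles t = F'.circles s
      + Nat.card {x : {x : c'.Comp // x ∉ Set.range ι} // F.tgt x = t} := by
  classical
  subst ht
  let back : c'.Comp → Diagram.Circle c c'' ⊕ {x : c'.Comp // x ∉ Set.range ι} := fun x =>
    if h : x ∈ Set.range ι then Sum.inl (Quot.mk _ (Sum.inr h.choose)) else Sum.inr ⟨x, h⟩
  have back_ι (y : c''.Comp) : back (ι y) = Sum.inl (Quot.mk _ (Sum.inr y)) := by
    have h : ι y ∈ Set.range ι := ⟨y, rfl⟩
    have e : h.choose = y := hι h.choose_spec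
    simp only [back, dif_pos h]
    rw [e]
    rfl
  have back_not {x : c'.Comp} (h : x ∉ Set.range ι) : back x = Sum.inr ⟨x, h⟩ := dif_neg h
  let θ : Diagram.Circle c c' ≃ Diagram.Circle c c'' ⊕ {x : c'.Comp // x ∉ Set.range ι} :=
    { toFun := Quot.lift (Sum.elim (fun x => Sum.inl (Quot.mk _ (Sum.inl x))) back) (by
        rintro _ _ ⟨p, rfl, rfl⟩
        simp only [Sum.elim_inl, Sum.elim_inr, ← hb, back_ι]
        exact congrArg Sum.inl (Quot.sound ⟨p, rfl, rfl⟩))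
      invFun := Sum.elim
        (Quot.lift (fun x => Quot.mk _ (x.map _root_.id ι)) (by
          rintro _ _ ⟨p, rfl, rfl⟩
          refine Quot.sound ⟨p, rfl, ?_⟩
          simp [hb]))
        (fun x => Quot.mk _ (Sum.inr x.1))
      left_inv := by
        intro q
        induction q using Quot.ind with
        | _ x =>
          cases x with
          | inl x => rfl
          | inr x =>
            by_cases h : x ∈ Set.range ι
            · obtain ⟨y, rfl⟩ := h
              simp only [Sum.elim_inr, back_ι]
              rfl
            · simp only [Sum.elim_inr, back_not h]
              rfl
      right_inv := by
        rintro (q | ⟨x, hx⟩)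
        · induction q using Quot.ind with
          | _ x =>
            cases x with
            | inl x => rfl
            | inr x => exact back_ι x
        · exact back_not hx }
  have hθ : ∀ q : Diagram.Circle c c'', e (F'.ofCircle q) = F.ofCircle (θ.symm (Sum.inl q)) := by
    intro q
    induction q using Quot.ind with
    | _ x =>
      cases x with
      | inl x => exact h1 x
      | inr x => exact h2 x
  rw [circles, circles, ← Nat.card_sum]
  refine Nat.card_congr ((θ.subtypeEquiv (q := fun z => F.ofCircle (θ.symm z) = e s)
    fun q => by simp).trans ((Equiv.subtypeSum).trans (Equiv.sumCongr ?_ ?_)))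
  · exact Equiv.subtypeEquivRight fun q => by rw [← hθ, e.apply_eq_iff_eq]
  · exact Equiv.subtypeEquivRight fun x => Iff.rfl

end Surface
end TangleMorse

/-! ### Capping cobordisms with discs and cylinders -/

namespace TangleMorse
namespace Surface

variable {P : Type} {c c' c'' : Diagram P}

/-- The surface obtained from `F` by gluing a cylinder to each component of `c'` in the range of
`ι` and a disc to each other component, with `δ x` dots on the piece glued to `x`. -/
noncomputable def capTop (F : Surface c c') (ι : c''.Comp → c'.Comp)
    (hb : ∀ p, ι (c''.bd p) = c'.bd p) (δ : c'.Comp → ℕ) : Surface c c'' where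
  Comp := F.Comp
  src := F.src
  tgt y := F.tgt (ι y)
  compat p := by rw [hb, F.compat]
  genus := F.genus
  dots s := F.dots s + ∑ᶠ x : {x : c'.Comp // F.tgt x = s}, δ x

theorem finsum_subtype_eq_single {α : Type} {M : Type*} [AddCommMonoid M] (a : α) (f : α → M) :
    ∑ᶠ x : {x // x = a}, f x = f a :=
  finsum_unique (fun x : {x // x = a} => f x)

/-- Capping off a cobordism with discs and cylinders does not change the genus. -/
theorem comp_homeo_capTop (F : Surface c c') (G : Surface c' c'') (σ : c'.Comp ≃ G.Comp)
    (hσ : ∀ x, σ x = G.src x) (hg : ∀ s, G.genus s = 0) (ι : c''.Comp → c'.Comp)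
    (hb : ∀ p, ι (c''.bd p) = c'.bd p) (hι : Function.Injective ι) (hG : ∀ y, σ (ι y) = G.tgt y) :
    (F.comp G).Homeo (F.capTop ι hb fun x => G.dots (σ x)) := by
  classical
  let e : GlueComp F G ≃ F.Comp :=
    { toFun := GlueComp.lift _root_.id (fun t => F.tgt (σ.symm t)) fun x => by simp [← hσ]
      invFun := GlueComp.inl F G
      left_inv := GlueComp.ind (fun _ => rfl) fun t => by
        refine (GlueComp.inl_tgt F G _).trans ?_
        rw [← hσ, σ.apply_symm_apply]
      right_inv := fun _ => rfl }
  have hl (q : GlueComp F G) (s : F.Comp) : GlueComp.inl F G s = q ↔ s = e q :=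
    e.apply_eq_iff_eq.symm
  have hr (q : GlueComp F G) (t : G.Comp) : GlueComp.inr F G t = q ↔ F.tgt (σ.symm t) = e q :=
    e.apply_eq_iff_eq.symm
  have hsrc (x : c.Comp) : e (GlueComp.inl F G (F.src x)) = F.src x := rfl
  have htgt (y : c''.Comp) : e (GlueComp.inr F G (G.tgt y)) = F.tgt (ι y) := by
    rw [← hG]
    exact congrArg F.tgt (σ.symm_apply_apply _)
  let miss (s : F.Comp) : ℕ :=
    Nat.card {x : {x : c'.Comp // x ∉ Set.range ι} // F.tgt x = s}
  have hC (q : GlueComp F G) : F.circles (e q) = glueCircles F G q + miss (e q) :=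
    card_circles_of_injection F (preComp F G) e ι hι hb hsrc htgt q _ rfl
  -- The piece glued to `x` is a cylinder or a disc. Compared with the cylinder over `x`, a disc
  -- lacks one boundary circle, so its Euler characteristic is larger by one.
  have hGE (x : c'.Comp) : G.euler (σ x) =
      c'.euler x + (Nat.card {z : {x : c'.Comp // x ∉ Set.range ι} // z.1 = x} : ℤ) := by
    have h := card_circles_of_injection (Surface.id c') G σ.symm ι hι hb
      (fun x => (congrArg σ.symm (hσ x)).symm.trans (σ.symm_apply_apply x))
      (fun y => (congrArg σ.symm (hG y)).symm.trans (σ.symm_apply_apply _)) (σ x) x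
      (σ.symm_apply_apply x)
    have h' := circles_id c' x
    have h2 : (Nat.card {z : {x : c'.Comp // x ∉ Set.range ι} // (Surface.id c').tgt z.1 = x} : ℤ)
      = (Nat.card {z : {x : c'.Comp // x ∉ Set.range ι} // z.1 = x} : ℤ) := rfl
    rw [euler, hg, ← h2]
    rw [h] at h'
    push_cast at h' ⊢
    linarith
  have hmiss (s : F.Comp) : ∑ᶠ x : {x : c'.Comp // F.tgt x = s},
      (Nat.card {z : {x : c'.Comp // x ∉ Set.range ι} // z.1 = x.1} : ℤ) = miss s := by
    have := Fintype.ofFinite {x : c'.Comp // F.tgt x = s}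
    rw [finsum_eq_sum_of_fintype, ← Nat.cast_sum, ← Nat.card_sigma]
    congr 1
    exact Nat.card_congr
      { toFun := fun z => ⟨z.2.1, by rw [z.2.2]; exact z.1.2⟩
        invFun := fun z => ⟨⟨z.1.1, z.2⟩, ⟨z.1, rfl⟩⟩
        left_inv := by
          rintro ⟨⟨x, hx⟩, ⟨z, hz⟩⟩
          obtain rfl : z.1 = x := hz
          rfl
        right_inv := fun _ => rfl }
  have hE (q : GlueComp F G) : glueEuler F G q = F.euler (e q) + miss (e q) := by
    have e1 : ∑ᶠ s : {s // GlueComp.inl F G s = q}, F.euler s = F.euler (e q) :=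
      (finsum_subtype_congr (p' := fun s => s = e q) (Equiv.refl F.Comp) (hl q) F.euler F.euler
        fun _ => rfl).trans (finsum_subtype_eq_single _ _)
    have e2 : ∑ᶠ t : {t // GlueComp.inr F G t = q}, G.euler t =
        ∑ᶠ x : {x // F.tgt x = e q}, G.euler (σ x) :=
      finsum_subtype_congr (p' := fun x => F.tgt x = e q) σ.symm (hr q) G.euler
        (fun x => G.euler (σ x)) (fun t => by rw [σ.apply_symm_apply])
    have e3 : ∑ᶠ x : {x // GlueComp.inl F G (F.tgt x) = q}, c'.euler x =
        ∑ᶠ x : {x // F.tgt x = e q}, c'.euler x :=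
      finsum_subtype_congr (p' := fun x => F.tgt x = e q) (Equiv.refl c'.Comp)
        (fun x => hl q (F.tgt x)) c'.euler c'.euler (fun _ => rfl)
    rw [glueEuler_eq, e1, e2, e3, add_sub_assoc,
      ← finsum_sub_distrib (Set.toFinite _) (Set.toFinite _), ← hmiss]
    congr 1
    exact finsum_congr fun x => by rw [hGE]; ring
  -- Each disc removes one boundary circle and adds one to the Euler characteristic. So `2 - b - χ`
  -- is unchanged and equals twice the genus; the halving and `toNat` lose nothing.
  have hgen (q : GlueComp F G) : F.genus (e q) = genusOf (glueCircles F G q) (glueEuler F G q) := by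
    rw [hE, genusOf, euler, hC]
    push_cast
    rw [show (2 - (glueCircles F G q : ℤ) - (2 - 2 * (F.genus (e q) : ℤ) -
      (glueCircles F G q + miss (e q)) + miss (e q))) = 2 * (F.genus (e q) : ℤ) by ring]
    simp
  refine ⟨e, hsrc, htgt, fun q => hgen q, fun q => Eq.trans ?_ (comp_dots F G q).symm⟩
  refine congrArg₂ (· + ·) ?_ ?_
  · exact ((finsum_subtype_congr (p' := fun s => s = e q) (Equiv.refl F.Comp) (hl q) F.dots F.dots
        fun _ => rfl).trans (finsum_subtype_eq_single _ _)).symm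
  · exact (finsum_subtype_congr (p' := fun x => F.tgt x = e q) σ.symm (hr q) _
      (fun x => G.dots (σ x)) (fun t => by rw [σ.apply_symm_apply])).symm

/-- `capTop` upside down. -/
noncomputable def capBot (F : Surface c' c) (ι : c''.Comp → c'.Comp)
    (hb : ∀ p, ι (c''.bd p) = c'.bd p) (δ : c'.Comp → ℕ) : Surface c'' c where
  Comp := F.Comp
  src y := F.src (ι y)
  tgt := F.tgt
  compat p := by rw [hb, F.compat]
  genus := F.genus
  dots s := F.dots s + ∑ᶠ x : {x : c'.Comp // F.src x = s}, δ x

theorem comp_homeo_capBot (F : Surface c' c) (G : Surface c'' c') (σ : c'.Comp ≃ G.Comp)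
    (hσ : ∀ x, σ x = G.tgt x) (hg : ∀ s, G.genus s = 0) (ι : c''.Comp → c'.Comp)
    (hb : ∀ p, ι (c''.bd p) = c'.bd p) (hι : Function.Injective ι) (hG : ∀ y, σ (ι y) = G.src y) :
    (G.comp F).Homeo (F.capBot ι hb fun x => G.dots (σ x)) :=
  ((comp_flip G F).trans (comp_homeo_capTop F.flip G.flip σ hσ hg ι hb hι hG)).flip

/-- The delooped cobordism: discs are glued to all loops, dotted on the loops of `c` which are not
in `r` and on the loops of `c'` which are in `r'`. -/
noncomputable def delooped (F : Surface c c') (r : Set c.Loop) (r' : Set c'.Loop) :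
    Surface c.deloop c'.deloop where
  Comp := F.Comp
  src x := F.src x.1
  tgt x := F.tgt x.1
  compat := F.compat
  genus := F.genus
  dots s := F.dots s + Nat.card {l : c.Loop // l ∉ r ∧ F.src l.1 = s}
    + Nat.card {l : c'.Loop // l ∈ r' ∧ F.tgt l.1 = s}

theorem finsum_indicator_loops {α : Type} (f : c.Comp → α) (a : α) (r : Set c.Loop) :
    ∑ᶠ x : {x : c.Comp // f x = a}, (Subtype.val '' r).indicator (fun _ => 1) x.1
      = Nat.card {l : c.Loop // l ∈ r ∧ f l.1 = a} := by
  classical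
  have := Fintype.ofFinite {x : c.Comp // f x = a}
  rw [finsum_eq_sum_of_fintype]
  simp only [Set.indicator_apply]
  rw [Finset.sum_boole, Nat.cast_id, ← Fintype.card_subtype, ← Nat.card_eq_fintype_card]
  exact Nat.card_congr
    { toFun := fun x => ⟨⟨x.1.1, by obtain ⟨l, _, hl⟩ := x.2; exact hl ▸ l.2⟩, by
          obtain ⟨l, hl, hx⟩ := x.2
          have e : l = ⟨x.1.1, hx ▸ l.2⟩ := Subtype.ext hx
          exact e ▸ hl, x.1.2⟩
      invFun := fun l => ⟨⟨l.1.1, l.2.2⟩, l.1, l.2.1, rfl⟩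
      left_inv := fun _ => rfl
      right_inv := fun _ => rfl }

/-- The discs are glued in two rounds, first below and then above, each time by a capping lemma. The
inverse of delooping dots the loops outside `r`, which explains the complement in the count. -/
theorem comp_homeo_delooped (F : Surface c c') (r : Set c.Loop) (r' : Set c'.Loop) :
    (((deloopInv c r).comp F).comp (deloopHom c' r')).Homeo (F.delooped r r') := by
  have h1 := comp_homeo_capBot F (deloopInv c r) (Equiv.refl c.Comp) (fun _ => rfl) (fun _ => rfl)
    (fun y : c.deloop.Comp => y.1) (fun _ => rfl) Subtype.val_injective (fun _ => rfl)
  refine (comp_homeo_capTop ((deloopInv c r).comp F) (deloopHom c' r') (Equiv.refl c'.Comp)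
    (fun _ => rfl) (fun _ => rfl) (fun y : c'.deloop.Comp => y.1) (fun _ => rfl)
    Subtype.val_injective (fun _ => rfl)).trans ?_
  obtain ⟨e, h1, h2, h3, h4⟩ := h1
  refine ⟨e, h1, fun y => h2 y.1, h3, fun s => ?_⟩
  have h5 : F.dots (e s) + _ = ((deloopInv c r).comp F).dots s := h4 s
  change F.dots (e s) + Nat.card {l : c.Loop // l ∈ rᶜ ∧ F.src l.1 = e s} +
    Nat.card {l : c'.Loop // l ∈ r' ∧ F.tgt l.1 = e s} = ((deloopInv c r).comp F).dots s + _
  refine congrArg₂ (· + ·) (Eq.trans ?_ h5) ((finsum_indicator_loops F.tgt (e s) r').symm.trans ?_)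
  · exact congrArg (F.dots (e s) + ·) (finsum_indicator_loops F.src (e s) rᶜ).symm
  refine finsum_subtype_congr (p := fun x => F.tgt x = e s) (Equiv.refl c'.Comp) (fun x => ?_) _ _
    fun _ => rfl
  exact (iff_of_eq (congrArg (· = e s) (h2 x))).symm.trans e.apply_eq_iff_eq

end Surface
end TangleMorse

namespace TangleMorse

/-! ## Consequences of the relations -/

namespace Surface

variable {P : Type} {c c' c'' : Diagram P}

/-- A component without boundary. -/
def Closed (F : Surface c c') (s : F.Comp) : Prop := (∀ x, F.src x ≠ s) ∧ ∀ x, F.tgt x ≠ s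

/-- The surface without the closed component `s`. -/
def remove (F : Surface c c') (s : F.Comp) (hs : F.Closed s) : Surface c c' where
  Comp := {t // t ≠ s}
  src x := ⟨F.src x, hs.1 x⟩
  tgt x := ⟨F.tgt x, hs.2 x⟩
  compat p := Subtype.ext (F.compat p)
  genus t := F.genus t
  dots t := F.dots t

theorem homeo_addSphere_remove (F : Surface c c') (s : F.Comp) (hs : F.Closed s)
    (hg : F.genus s = 0) : ((F.remove s hs).addSphere (F.dots s)).Homeo F := by
  classical
  refine ⟨Equiv.optionSubtypeNe s, fun x => rfl, fun x => rfl, ?_, ?_⟩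
  · rintro (_ | t)
    · exact hg
    · rfl
  · rintro (_ | t) <;> rfl

theorem of_mem_rel_of_homeo {F G : Surface c c'} (h : F.Homeo G) (hG : Mor.of G ∈ Mor.rel c c') :
    Mor.of F ∈ Mor.rel c c' := by
  rw [← sub_add_cancel (Mor.of F) (Mor.of G)]
  exact add_mem (AddSubgroup.subset_closure (.homeo F G h)) hG

theorem of_mem_rel_of_sphere (F : Surface c c') (s : F.Comp) (hs : F.Closed s)
    (hg : F.genus s = 0) (hd : F.dots s = 0) : Mor.of F ∈ Mor.rel c c' :=
  of_mem_rel_of_homeo (homeo_addSphere_remove F s hs hg).symm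
    (hd ▸ AddSubgroup.subset_closure (.sphere _))

theorem of_sub_of_remove_mem_rel (F : Surface c c') (s : F.Comp) (hs : F.Closed s)
    (hg : F.genus s = 0) (hd : F.dots s = 1) :
    Mor.of F - Mor.of (F.remove s hs) ∈ Mor.rel c c' := by
  rw [← sub_add_sub_cancel (Mor.of F) (Mor.of ((F.remove s hs).addSphere (F.dots s)))]
  refine add_mem (AddSubgroup.subset_closure (.homeo _ _ (homeo_addSphere_remove F s hs hg).symm)) ?_
  rw [hd]
  exact AddSubgroup.subset_closure (.dottedSphere _)

theorem of_mem_rel_of_two_le_dots (F : Surface c c') (s : F.Comp) (hd : 2 ≤ F.dots s) :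
    Mor.of F ∈ Mor.rel c c' := by
  classical
  -- The truncated subtraction is exact at `s` by `hd`, so restoring two dots gives back `F`.
  let F' : Surface c c' := { F with dots := fun t => F.dots t - if t = s then 2 else 0 }
  refine of_mem_rel_of_homeo (G := (F'.addDot s).addDot s)
    ⟨Equiv.refl _, fun _ => rfl, fun _ => rfl, fun _ => rfl, fun t => ?_⟩
    (AddSubgroup.subset_closure (.twoDots F' s))
  change (F.dots t - if t = s then 2 else 0) + (if t = s then 1 else 0) + (if t = s then 1 else 0)
    = F.dots t
  split_ifs with h
  · subst h; omega
  · simp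

/-- A closed component of genus zero is a sphere: without dots the sphere relation kills the
surface, with at least two dots the two-dots relation does. -/
theorem dots_of_not_mem_rel {F : Surface c c'} (h : Mor.of F ∉ Mor.rel c c') {s : F.Comp}
    (hs : F.Closed s) (hg : F.genus s = 0) : F.dots s = 1 := by
  by_contra hd
  rcases Nat.lt_or_ge (F.dots s) 2 with h2 | h2
  · exact h (of_mem_rel_of_sphere F s hs hg (by omega))
  · exact h (of_mem_rel_of_two_le_dots F s h2)

/-- If a surface consists of undotted strips and of spheres with one dot, and the strips join
corresponding components, then it is the identity. -/
theorem of_sub_of_id_mem_rel (F : Surface c c) (hst : ∀ x, F.tgt x = F.src x)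
    (hi : Function.Injective F.src) (hg : ∀ s, F.genus s = 0)
    (h0 : ∀ s ∈ Set.range F.src, F.dots s = 0) (h1 : ∀ s ∉ Set.range F.src, F.dots s = 1) :
    Mor.of F - Mor.of (Surface.id c) ∈ Mor.rel c c := by
  classical
  induction hn : Nat.card F.Comp using Nat.strong_induction_on generalizing F with
  | _ n ih =>
    by_cases hsurj : Function.Surjective F.src
    · refine AddSubgroup.subset_closure (.homeo _ _ (Homeo.symm
        ⟨Equiv.ofBijective F.src ⟨hi, hsurj⟩, fun _ => rfl, fun x => (hst x).symm, fun x => ?_,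
          fun x => ?_⟩))
      · exact hg _
      · exact h0 _ ⟨x, rfl⟩
    · rw [Function.Surjective] at hsurj
      push Not at hsurj
      obtain ⟨s, hs⟩ := hsurj
      -- Since `tgt` and `src` agree, a component missed by `src` has no boundary at all. It is a
      -- sphere with one dot and can be removed, which lowers the number of components.
      have hcl : F.Closed s := ⟨hs, fun x => by rw [hst]; exact hs x⟩
      rw [← sub_add_sub_cancel (Mor.of F) (Mor.of (F.remove s hcl))]
      refine add_mem (of_sub_of_remove_mem_rel F s hcl (hg s)
        (h1 s (by rintro ⟨x, hx⟩; exact hs x hx))) ?_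
      refine ih (Nat.card {t // t ≠ s}) ?_ (F.remove s hcl) (fun x => Subtype.ext (hst x))
        (fun x y h => hi (congrArg Subtype.val h)) (fun t => hg t.1) ?_ ?_ rfl
      · rw [← hn]
        exact Finite.card_subtype_lt (p := fun t => t ≠ s) (x := s) (by simp)
      · rintro _ ⟨x, rfl⟩
        exact h0 _ ⟨x, rfl⟩
      · intro t ht
        refine h1 _ ?_
        rintro ⟨x, hx⟩
        exact ht ⟨x, Subtype.ext hx⟩

/-- The surface consists of undotted strips, each joining one component of `c` to one component
of `c'`, and of spheres with one dot. -/
structure IsStrips (F : Surface c c') : Prop where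
  src_injective : Function.Injective F.src
  tgt_injective : Function.Injective F.tgt
  range_eq : Set.range F.src = Set.range F.tgt
  genus : ∀ s, F.genus s = 0
  dots_range : ∀ s ∈ Set.range F.src, F.dots s = 0
  dots_closed : ∀ s ∉ Set.range F.src, F.dots s = 1

theorem IsStrips.of_homeo {F G : Surface c c'} (hG : G.IsStrips) (h : G.Homeo F) : F.IsStrips := by
  obtain ⟨e, h1, h2, h3, h4⟩ := h
  have hs : Set.range F.src = e '' Set.range G.src := by
    rw [← Set.range_comp]; exact congrArg Set.range (funext fun x => (h1 x).symm)
  have ht : Set.range F.tgt = e '' Set.range G.tgt := by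
    rw [← Set.range_comp]; exact congrArg Set.range (funext fun x => (h2 x).symm)
  have hmem (s : G.Comp) : e s ∈ Set.range F.src ↔ s ∈ Set.range G.src := by
    rw [hs, e.injective.mem_set_image]
  refine ⟨fun x y h => ?_, fun x y h => ?_, by rw [hs, ht, hG.range_eq], fun s => ?_,
    fun s hs => ?_, fun s hs => ?_⟩
  · rw [← h1, ← h1] at h
    exact hG.src_injective (e.injective h)
  · rw [← h2, ← h2] at h
    exact hG.tgt_injective (e.injective h)
  all_goals obtain ⟨s, rfl⟩ := e.surjective s
  · rw [h3, hG.genus]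
  · rw [h4, hG.dots_range _ ((hmem s).1 hs)]
  · rw [h4, hG.dots_closed _ (mt (hmem s).2 hs)]

/-- A strip has Euler characteristic 1 and no dot, and a sphere with one dot contributes `2 - 2 =
0`. The total is the number of arcs of `c`, which the definition of the degree subtracts. -/
theorem IsStrips.degree {F : Surface c c'} (hF : F.IsStrips) (hc : ∀ x, c.IsArc x) (m : ℤ) :
    F.degree m m = 0 := by
  classical
  have := Fintype.ofFinite F.Comp
  have hsrc (p : P) : F.src (c.bd p) = F.tgt (c'.bd p) := F.compat p
  have hq : ∀ q : Diagram.Circle c c', ∃ p, q = Quot.mk _ (Sum.inl (c.bd p)) := by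
    intro q
    induction q using Quot.ind with
    | _ z =>
      cases z with
      | inl x => obtain ⟨p, rfl⟩ := hc x; exact ⟨p, rfl⟩
      | inr y =>
        obtain ⟨x, hx⟩ : F.tgt y ∈ Set.range F.src := hF.range_eq ▸ ⟨y, rfl⟩
        obtain ⟨p, rfl⟩ := hc x
        refine ⟨p, ?_⟩
        rw [hsrc] at hx
        rw [← hF.tgt_injective hx]
        exact (Quot.sound ⟨p, rfl, rfl⟩).symm
  have hinj : Function.Injective F.ofCircle := by
    intro q q' h
    obtain ⟨p, rfl⟩ := hq q
    obtain ⟨p', rfl⟩ := hq q'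
    exact congrArg (fun x => Quot.mk _ (Sum.inl x)) (hF.src_injective h)
  have hterm (s : F.Comp) : F.euler s - 2 * (F.dots s : ℤ) =
      if s ∈ Set.range F.src then 1 else 0 := by
    split_ifs with h
    · obtain ⟨x, rfl⟩ := h
      have : F.circles (F.src x) = 1 :=
        card_fiber_eq_one hinj (Quot.mk _ (Sum.inl x))
      rw [euler, this, hF.genus, hF.dots_range _ ⟨x, rfl⟩]
      norm_num
    · have : F.circles s = 0 := by
        refine Nat.card_eq_zero.2 (Or.inl ⟨?_⟩)
        rintro ⟨q, rfl⟩
        obtain ⟨p, rfl⟩ := hq q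
        exact h ⟨_, rfl⟩
      rw [euler, this, hF.genus, hF.dots_closed _ h]
      norm_num
  have hsum : ∑ s, (F.euler s - 2 * (F.dots s : ℤ)) = Nat.card c.Comp := by
    rw [Finset.sum_congr rfl fun s _ => hterm s, Finset.sum_boole, ← Fintype.card_subtype,
      ← Nat.card_eq_fintype_card]
    exact congrArg Nat.cast (Nat.card_congr (Equiv.ofInjective F.src hF.src_injective).symm)
  rw [Surface.degree, finsum_eq_sum_of_fintype, finsum_eq_sum_of_fintype,
    Nat.card_congr (Equiv.subtypeUnivEquiv hc), ← hsum, Finset.sum_sub_distrib, ← Finset.mul_sum]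
  push_cast
  ring

end Surface

/-! ### Matrix elements consisting of strips and dotted spheres -/

namespace Mor

variable {P : Type} {c c' c'' : Diagram P}

theorem comp_single (F : Surface c c') (G : Surface c' c'') (m n : ℤ) :
    comp (Finsupp.single F m) (Finsupp.single G n) = Finsupp.single (F.comp G) (m * n) := by
  rw [comp, Finsupp.sum_single_index, Finsupp.sum_single_index] <;> simp

theorem comp_zero (f : Mor c c') : comp f (0 : Mor c' c'') = 0 := by
  simp [comp]

theorem zero_comp (g : Mor c' c'') : comp (0 : Mor c c') g = 0 := by
  simp [comp]

theorem degreeZero_single {F : Surface c c'} {m m' : ℤ} (h : F.degree m m' = 0) (u : ℤ) :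
    DegreeZero (Finsupp.single F u : Mor c c') m m' := by
  classical
  intro G hG
  obtain rfl := Finset.mem_singleton.1 (Finsupp.support_single_subset hG)
  exact h

theorem of_not_mem_rel_of_single {F : Surface c c'} {u : ℤ}
    (h : (Finsupp.single F u : Mor c c') ∉ rel c c') : of F ∉ rel c c' := by
  intro hF
  refine h ?_
  have : (Finsupp.single F u : Mor c c') = u • of F := by simp [of]
  rw [this]
  exact zsmul_mem hF u

/-- Undotted strips and spheres with one dot form an isomorphism. -/
theorem isIso_single_of_isStrips {F : Surface c c'} (hF : F.IsStrips) (hc : ∀ x, c.IsArc x)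
    (hc' : ∀ x, c'.IsArc x) {u : ℤ} (hu : u * u = 1) (m : ℤ) :
    IsIso (Finsupp.single F u : Mor c c') m m := by
  classical
  let φ : c.Comp ≃ c'.Comp := (Equiv.ofInjective F.src hF.src_injective).trans
    ((Equiv.setCongr hF.range_eq).trans (Equiv.ofInjective F.tgt hF.tgt_injective).symm)
  have hφ (x : c.Comp) : F.tgt (φ x) = F.src x :=
    Equiv.apply_ofInjective_symm hF.tgt_injective _
  have hb (p : P) : φ (c.bd p) = c'.bd p := hF.tgt_injective (by rw [hφ, F.compat])
  have hb' (p : P) : φ.symm (c'.bd p) = c.bd p := by rw [← hb, φ.symm_apply_apply]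
  -- The inverse consists of the strips read backwards. It needs no spheres, since the spheres of
  -- `F` have one dot each and evaluate to 1.
  let G : Surface c' c :=
    { Comp := c.Comp
      src := φ.symm
      tgt := fun x => x
      compat := hb'
      genus := fun _ => 0
      dots := fun _ => 0 }
  have hG : G.IsStrips := ⟨φ.symm.injective, fun _ _ h => h,
    (φ.symm.surjective.range_eq).trans Function.surjective_id.range_eq.symm, fun _ => rfl,
    fun _ _ => rfl, fun s hs => absurd (φ.symm.surjective.range_eq ▸ Set.mem_univ s) hs⟩
  refine ⟨degreeZero_single (hF.degree hc m) u, Finsupp.single G u,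
    degreeZero_single (hG.degree hc' m) u, ?_, ?_⟩
  · rw [comp_single, hu]
    have h := Surface.comp_homeo_capTop F G φ.symm (fun _ => rfl) (fun _ => rfl) φ hb φ.injective
      φ.symm_apply_apply
    have hd (s : F.Comp) : (F.capTop φ hb fun x => G.dots (φ.symm x)).dots s = F.dots s := by
      change F.dots s + ∑ᶠ _ : {x // F.tgt x = s}, (0 : ℕ) = F.dots s
      simp
    rw [← sub_add_sub_cancel _ (of (F.capTop φ hb fun x => G.dots (φ.symm x)))]
    exact add_mem (AddSubgroup.subset_closure (.homeo _ _ h))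
      (Surface.of_sub_of_id_mem_rel _ hφ hF.src_injective hF.genus
        (fun s hs => (hd s).trans (hF.dots_range s hs))
        (fun s hs => (hd s).trans (hF.dots_closed s hs)))
  · rw [comp_single, hu]
    have h := Surface.comp_homeo_capBot F G (Equiv.refl c.Comp) (fun _ => rfl) (fun _ => rfl)
      φ.symm hb' φ.symm.injective (fun _ => rfl)
    have hd (s : F.Comp) : (F.capBot φ.symm hb' fun x => G.dots (Equiv.refl c.Comp x)).dots s
        = F.dots s := by
      change F.dots s + ∑ᶠ _ : {x // F.src x = s}, (0 : ℕ) = F.dots s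
      simp
    have hsrc : Set.range (F.capBot φ.symm hb' fun x => G.dots (Equiv.refl c.Comp x)).src
        = Set.range F.src := φ.symm.surjective.range_comp F.src
    rw [← sub_add_sub_cancel _ (of (F.capBot φ.symm hb' fun x => G.dots (Equiv.refl c.Comp x)))]
    exact add_mem (AddSubgroup.subset_closure (.homeo _ _ h))
      (Surface.of_sub_of_id_mem_rel _
        (fun y => (congrArg F.tgt (φ.apply_symm_apply y)).symm.trans (hφ _))
        (hF.src_injective.comp φ.symm.injective) hF.genus
        (fun s hs => (hd s).trans (hF.dots_range s (hsrc ▸ hs)))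
        (fun s hs => (hd s).trans (hF.dots_closed s (hsrc ▸ hs))))

end Mor
end TangleMorse

namespace TangleMorse
namespace MorsePresentation

/-! ## Components of smoothings -/

variable {T : MorsePresentation}

theorem Crossing.fits (j : T.Crossing) : T.bars j.1 + 2 ≤ T.width j.1.castSucc ∧
    T.width j.1.succ = T.width j.1.castSucc := by
  have h := T.fits j.1
  rcases j.2 with hj | hj <;> rwa [hj] at h

/-- The node to the lower left of a crossing. -/
def Crossing.bl (j : T.Crossing) : T.Node :=
  ⟨j.1.castSucc, ⟨T.bars j.1, by have := j.fits; omega⟩⟩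

/-- The node to the lower right of a crossing. -/
def Crossing.br (j : T.Crossing) : T.Node :=
  ⟨j.1.castSucc, ⟨T.bars j.1 + 1, by have := j.fits; omega⟩⟩

/-- The node to the upper left of a crossing. -/
def Crossing.tl (j : T.Crossing) : T.Node :=
  ⟨j.1.succ, ⟨T.bars j.1, by have := j.fits; omega⟩⟩

/-- The node to the upper right of a crossing. -/
def Crossing.tr (j : T.Crossing) : T.Node :=
  ⟨j.1.succ, ⟨T.bars j.1 + 1, by have := j.fits; omega⟩⟩

namespace Smoothing

variable (s s' : T.Smoothing)

/-- The component of the smoothed diagram that contains a node. -/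
def cls (x : T.Node) : s.diagram.Comp := Quot.mk _ x

variable {s s'}

theorem cls_surjective (c : s.diagram.Comp) : ∃ x, s.cls x = c := Quot.exists_rep c

theorem cls_eq_of_joined {x y : T.Node} (h : s.Joined x y) : s.cls x = s.cls y := Quot.sound h

/-- A function that is constant along the segments is constant on components. -/
theorem eq_of_cls_eq {α : Sort*} (f : T.Node → α) (hf : ∀ x y, s.Joined x y → f x = f y)
    {x y : T.Node} (h : s.cls x = s.cls y) : f x = f y :=
  congrArg (Quot.lift f hf) h

theorem isArc_cls_iff {x : T.Node} :
    s.diagram.IsArc (s.cls x) ↔ ∃ p, s.cls (T.endNode p) = s.cls x := Iff.rfl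

variable (s s') in
/-- The component of the saddle that contains a node. -/
def sad (x : T.Node) : (saddle s s').Comp := Quot.mk _ x

theorem sad_eq_of_joined {x y : T.Node} (h : s.Joined x y ∨ s'.Joined x y) :
    sad s s' x = sad s s' y := Quot.sound h

theorem eq_of_sad_eq {α : Sort*} (f : T.Node → α) (hf : ∀ x y, s.Joined x y → f x = f y)
    (hf' : ∀ x y, s'.Joined x y → f x = f y) {x y : T.Node} (h : sad s s' x = sad s s' y) :
    f x = f y :=
  congrArg (Quot.lift f fun x y h => h.elim (hf x y) (hf' x y)) h

theorem sad_eq_of_cls_eq {x y : T.Node} (h : s.cls x = s.cls y) : sad s s' x = sad s s' y :=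
  eq_of_cls_eq (sad s s') (fun _ _ h => sad_eq_of_joined (Or.inl h)) h

theorem sad_eq_of_cls_eq' {x y : T.Node} (h : s'.cls x = s'.cls y) : sad s s' x = sad s s' y :=
  eq_of_cls_eq (sad s s') (fun _ _ h => sad_eq_of_joined (Or.inr h)) h

/-! ### Heights of loops -/

theorem isArc_of_last {x : T.Node} (h : x.1 = Fin.last T.len) : s.diagram.IsArc (s.cls x) := by
  obtain ⟨h', i⟩ := x
  subst h
  exact ⟨Sum.inr i, rfl⟩

theorem isArc_of_zero {x : T.Node} (h : x.1 = 0) : s.diagram.IsArc (s.cls x) := by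
  obtain ⟨h', i⟩ := x
  subst h
  exact ⟨Sum.inl i, rfl⟩

theorem le_maxLayer (l : s.diagram.Loop) (j : Fin T.len) (x : T.Node)
    (hx : x.1 = j.castSucc ∨ x.1 = j.succ) (hl : s.cls x = l.1) : j.1 + 1 ≤ s.maxLayer l := by
  refine le_csSup ⟨T.len, ?_⟩ ⟨j, x, rfl, hx, hl⟩
  rintro _ ⟨j, x, rfl, -, -⟩
  exact j.2

theorem height_lt_maxLayer (l : s.diagram.Loop) (x : T.Node) (hl : s.cls x = l.1) :
    x.1.1 < s.maxLayer l := by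
  have hx : x.1 ≠ Fin.last T.len := fun h => l.2 (hl ▸ isArc_of_last h)
  exact le_maxLayer l (x.1.castPred hx) x (Or.inl (Fin.castSucc_castPred _ hx).symm) hl

theorem maxLayer_le (l : s.diagram.Loop) (n : ℕ) (h : ∀ x, s.cls x = l.1 → x.1.1 ≤ n) :
    s.maxLayer l ≤ n + 1 := by
  refine csSup_le' ?_
  rintro _ ⟨j, x, rfl, hx, hl⟩
  have := h x hl
  rcases hx with hx | hx <;> rw [hx] at this <;> simp at this <;> omega

/-! ### Smoothings which differ in one crossing -/

/-- Two smoothings which differ only at `j`, where the first is horizontal and the second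
vertical. -/
structure IsPair (s s' : T.Smoothing) (j : T.Crossing) : Prop where
  horiz : s.flat j.1 = .horiz
  vert : s'.flat j.1 = .vert
  other : ∀ k, k ≠ j.1 → s.flat k = s'.flat k

theorem Changes.flat_eq {j : T.Crossing} (h : s.Changes s' j) (k : Fin T.len) (hk : k ≠ j.1) :
    s.flat k = s'.flat k := by
  have h2 := h.2.2
  simp only [flat]
  split_ifs with h3 h4 h5 h6 h7 <;> first | rfl | skip
  all_goals first
    | rw [h2 ⟨k, Or.inl h3⟩ (fun e => hk (congrArg Subtype.val e))] at *; contradiction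
    | rw [h2 ⟨k, Or.inr (by assumption)⟩ (fun e => hk (congrArg Subtype.val e))] at *; contradiction

theorem Changes.isPair_of_neg {j : T.Crossing} (h : s.Changes s' j) (hj : T.layer j.1 = .neg) :
    IsPair s s' j := by
  refine ⟨?_, ?_, h.flat_eq⟩
  · have := h.1
    simp [flat, hj, this]
  · have := h.2.1
    simp [flat, hj, this]

/-- The pair is ordered by shape and not by the direction of the differential, so one analysis of
the horizontal and the vertical smoothing serves both kinds of crossing. -/
theorem Changes.isPair_of_pos {j : T.Crossing} (h : s.Changes s' j) (hj : T.layer j.1 = .pos) :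
    IsPair s' s j := by
  refine ⟨?_, ?_, fun k hk => (h.flat_eq k hk).symm⟩
  · have := h.2.1
    simp [flat, hj, this]
  · have := h.1
    simp [flat, hj, this]

namespace IsPair

variable {j : T.Crossing} (h : IsPair s s' j)
include h

theorem joined_bottom : s.Joined j.bl j.br :=
  .bottom j.1 _ _ (by rw [h.horiz]; exact ⟨rfl, rfl⟩)

theorem joined_top : s.Joined j.tl j.tr :=
  .top j.1 _ _ (by rw [h.horiz]; exact ⟨rfl, rfl⟩)

theorem joined_left : s'.Joined j.bl j.tl :=
  .through j.1 _ _ (by rw [h.vert]; rfl)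

theorem joined_right : s'.Joined j.br j.tr :=
  .through j.1 _ _ (by rw [h.vert]; rfl)

theorem joined_horiz {x y : T.Node} (hxy : s.Joined x y) :
    s'.Joined x y ∨ (x = j.bl ∧ y = j.br) ∨ (x = j.tl ∧ y = j.tr) := by
  cases hxy with
  | bottom k x y hxy =>
    by_cases hk : k = j.1
    · subst hk
      rw [h.horiz] at hxy
      exact Or.inr (Or.inl ⟨Sigma.ext rfl (heq_of_eq (Fin.ext hxy.1)),
        Sigma.ext rfl (heq_of_eq (Fin.ext hxy.2))⟩)
    · exact Or.inl (.bottom k x y (h.other k hk ▸ hxy))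
  | top k x y hxy =>
    by_cases hk : k = j.1
    · subst hk
      rw [h.horiz] at hxy
      exact Or.inr (Or.inr ⟨Sigma.ext rfl (heq_of_eq (Fin.ext hxy.1)),
        Sigma.ext rfl (heq_of_eq (Fin.ext hxy.2))⟩)
    · exact Or.inl (.top k x y (h.other k hk ▸ hxy))
  | through k x y hxy =>
    by_cases hk : k = j.1
    · subst hk
      rw [h.horiz] at hxy
      exact Or.inl (.through j.1 x y (by rw [h.vert]; exact hxy.1))
    · exact Or.inl (.through k x y (h.other k hk ▸ hxy))

theorem joined_vert {x y : T.Node} (hxy : s'.Joined x y) :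
    s.Joined x y ∨ (x = j.bl ∧ y = j.tl) ∨ (x = j.br ∧ y = j.tr) := by
  cases hxy with
  | bottom k x y hxy =>
    by_cases hk : k = j.1
    · subst hk
      rw [h.vert] at hxy
      exact hxy.elim
    · exact Or.inl (.bottom k x y (h.other k hk ▸ hxy))
  | top k x y hxy =>
    by_cases hk : k = j.1
    · subst hk
      rw [h.vert] at hxy
      exact hxy.elim
    · exact Or.inl (.top k x y (h.other k hk ▸ hxy))
  | through k x y hxy =>
    by_cases hk : k = j.1
    · subst hk
      rw [h.vert] at hxy
      have hxy : y.1 = x.1 := hxy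
      by_cases h1 : x.1 = T.bars j.1
      · exact Or.inr (Or.inl ⟨Sigma.ext rfl (heq_of_eq (Fin.ext h1)),
          Sigma.ext rfl (heq_of_eq (Fin.ext (hxy.trans h1)))⟩)
      by_cases h2 : x.1 = T.bars j.1 + 1
      · exact Or.inr (Or.inr ⟨Sigma.ext rfl (heq_of_eq (Fin.ext h2)),
          Sigma.ext rfl (heq_of_eq (Fin.ext (hxy.trans h2)))⟩)
      exact Or.inl (.through j.1 x y (by rw [h.horiz]; exact ⟨hxy, by omega⟩))
    · exact Or.inl (.through k x y (h.other k hk ▸ hxy))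

end IsPair

/-- One of the four nodes around a crossing. -/
def Around (j : T.Crossing) (x : T.Node) : Prop := x = j.bl ∨ x = j.br ∨ x = j.tl ∨ x = j.tr

theorem Around.height {j : T.Crossing} {x : T.Node} (h : Around j x) :
    x.1 = j.1.castSucc ∨ x.1 = j.1.succ := by
  rcases h with rfl | rfl | rfl | rfl
  · exact Or.inl rfl
  · exact Or.inl rfl
  · exact Or.inr rfl
  · exact Or.inr rfl

/-- The segments of two smoothings agree away from a crossing. -/
def AgreeOff (s s' : T.Smoothing) (j : T.Crossing) : Prop :=
  ∀ x y, s.Joined x y → s'.Joined x y ∨ (Around j x ∧ Around j y)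

theorem IsPair.agreeOff {j : T.Crossing} (h : IsPair s s' j) : AgreeOff s s' j := by
  intro x y hxy
  rcases h.joined_horiz hxy with h | ⟨rfl, rfl⟩ | ⟨rfl, rfl⟩
  · exact Or.inl h
  all_goals simp [Around]

theorem IsPair.agreeOff' {j : T.Crossing} (h : IsPair s s' j) : AgreeOff s' s j := by
  intro x y hxy
  rcases h.joined_vert hxy with h | ⟨rfl, rfl⟩ | ⟨rfl, rfl⟩
  · exact Or.inl h
  all_goals simp [Around]

theorem Changes.agreeOff {j : T.Crossing} (h : s.Changes s' j) :
    AgreeOff s s' j ∧ AgreeOff s' s j := by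
  rcases j.2 with hj | hj
  · exact ⟨(h.isPair_of_pos hj).agreeOff', (h.isPair_of_pos hj).agreeOff⟩
  · exact ⟨(h.isPair_of_neg hj).agreeOff, (h.isPair_of_neg hj).agreeOff'⟩

/-- The component of `x` does not meet the crossing `j`. -/
def Avoids (s : T.Smoothing) (j : T.Crossing) (x : T.Node) : Prop :=
  ∀ z, Around j z → s.cls z ≠ s.cls x

/-- The component of `x` is closed under the segments of both smoothings: a segment of `s'` that is
not one of `s` has both ends at the crossing, hence outside the component. -/
theorem Avoids.sad_eq {j : T.Crossing} {x z : T.Node} (hx : s.Avoids j x) (h : AgreeOff s' s j)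
    (hz : sad s s' z = sad s s' x) : s.cls z = s.cls x := by
  have := eq_of_sad_eq (fun z => s.cls z = s.cls x)
    (fun y z hyz => by rw [cls_eq_of_joined hyz]) (fun y z hyz => ?_) hz
  · exact this.mpr rfl
  · rcases h y z hyz with hyz | ⟨hy, hz⟩
    · rw [cls_eq_of_joined hyz]
    · exact propext ⟨fun e => absurd e (hx y hy), fun e => absurd e (hx z hz)⟩

theorem Avoids.cls_eq {j : T.Crossing} {x z : T.Node} (hx : s.Avoids j x) (h : AgreeOff s s' j)
    (hz : s.cls z = s.cls x) : s'.cls z = s'.cls x := by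
  classical
  -- Sending everything off the component to `none` hides the segments at the crossing, the only
  -- ones that `s'` may lack.
  have := eq_of_cls_eq (fun z => if s.cls z = s.cls x then some (s'.cls z) else none)
    (fun y z hyz => ?_) hz
  · simpa [hz] using this
  · rcases h y z hyz with hyz' | ⟨hy, hz⟩
    · simp only [cls_eq_of_joined hyz, cls_eq_of_joined hyz']
    · simp only [if_neg (hx y hy), if_neg (hx z hz)]

theorem Avoids.cls_eq_iff {j : T.Crossing} {x z : T.Node} (hx : s.Avoids j x)
    (h : AgreeOff s s' j) (h' : AgreeOff s' s j) : s'.cls z = s'.cls x ↔ s.cls z = s.cls x :=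
  ⟨fun hz => hx.sad_eq h' (sad_eq_of_cls_eq' hz), hx.cls_eq h⟩

theorem Avoids.of_agreeOff {j : T.Crossing} {x : T.Node} (hx : s.Avoids j x)
    (h : AgreeOff s s' j) (h' : AgreeOff s' s j) : s'.Avoids j x :=
  fun z hz e => hx z hz ((hx.cls_eq_iff h h').1 e)

theorem Avoids.isArc_iff {j : T.Crossing} {x : T.Node} (hx : s.Avoids j x)
    (h : AgreeOff s s' j) (h' : AgreeOff s' s j) :
    s'.diagram.IsArc (s'.cls x) ↔ s.diagram.IsArc (s.cls x) := by
  simp only [isArc_cls_iff, hx.cls_eq_iff h h']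

end Smoothing
end MorsePresentation
end TangleMorse

namespace TangleMorse
namespace MorsePresentation

/-! ## Parity of the number of intersections with horizontal lines -/

/-- The positions `p` and `p + 1` are taken out and the gap is closed, which is the renumbering of
strings at a cap or a cup. -/
theorem sum_range_add_two {M : Type*} [AddCommMonoid M] (f : ℕ → M) (p n : ℕ) (h : p ≤ n) :
    ∑ i ∈ Finset.range (n + 2), f i =
      ∑ i ∈ Finset.range n, (if i < p then f i else f (i + 2)) + (f p + f (p + 1)) := by
  induction n, h using Nat.le_induction with
  | base =>
    rw [Finset.sum_range_succ, Finset.sum_range_succ, add_assoc]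
    congr 1
    exact Finset.sum_congr rfl fun i hi => by rw [if_pos (Finset.mem_range.1 hi)]
  | succ n h ih =>
    rw [Finset.sum_range_succ, ih, Finset.sum_range_succ _ n, if_neg (by omega)]
    abel

theorem sum_range_add_two_of_eq (f : ℕ → ZMod 2) (p n : ℕ) (h : p ≤ n) (hp : f p = f (p + 1)) :
    ∑ i ∈ Finset.range (n + 2), f i =
      ∑ i ∈ Finset.range n, (if i < p then f i else f (i + 2)) := by
  rw [sum_range_add_two f p n h, hp, CharTwo.add_self_eq_zero, add_zero]

variable {T : MorsePresentation}

open Classical in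
/-- Whether the position `i` at height `h` belongs to `S`. -/
noncomputable def indicatorAt (S : Set T.Node) (h : Fin (T.len + 1)) (i : ℕ) : ZMod 2 :=
  if ∃ hi : i < T.width h, (⟨h, ⟨i, hi⟩⟩ : T.Node) ∈ S then 1 else 0

/-- The parity of the number of nodes in `S` at height `h`. -/
noncomputable def parity (S : Set T.Node) (h : Fin (T.len + 1)) : ZMod 2 :=
  ∑ i ∈ Finset.range (T.width h), indicatorAt S h i

theorem indicatorAt_congr {S : Set T.Node} {x y : T.Node} (h : x ∈ S ↔ y ∈ S) :
    indicatorAt S x.1 x.2.1 = indicatorAt S y.1 y.2.1 := by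
  have hx (x : T.Node) : (∃ hi : x.2.1 < T.width x.1, (⟨x.1, ⟨x.2.1, hi⟩⟩ : T.Node) ∈ S) ↔ x ∈ S :=
    ⟨fun h => h.2, fun h => ⟨x.2.2, h⟩⟩
  classical
  unfold indicatorAt
  exact if_congr ((hx x).trans (h.trans (hx y).symm)) rfl rfl

theorem parity_eq_zero {S : Set T.Node} {h : Fin (T.len + 1)} (hS : ∀ x ∈ S, x.1 ≠ h) :
    parity S h = 0 := by
  refine Finset.sum_eq_zero fun i _ => if_neg ?_
  rintro ⟨hi, hx⟩
  exact hS _ hx rfl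

/-- A set of nodes that is closed under the segments of a layer has the same parity below and
above the layer. -/
theorem parity_castSucc_eq_parity_succ (s : T.Smoothing) (S : Set T.Node) (j : Fin T.len)
    (hS : ∀ x y, (s.flat j).Through (T.bars j) x.1 y.1 → (⟨j.castSucc, x⟩ ∈ S ↔ ⟨j.succ, y⟩ ∈ S))
    (hS' : ∀ x y, (s.flat j).Bottom (T.bars j) x.1 y.1 →
      (⟨j.castSucc, x⟩ ∈ S ↔ ⟨j.castSucc, y⟩ ∈ S))
    (hS'' : ∀ x y, (s.flat j).Top (T.bars j) x.1 y.1 → (⟨j.succ, x⟩ ∈ S ↔ ⟨j.succ, y⟩ ∈ S)) :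
    parity S j.castSucc = parity S j.succ := by
  have hthrough (x y : ℕ) (hx : x < T.width j.castSucc) (hy : y < T.width j.succ)
      (h : (s.flat j).Through (T.bars j) x y) :
      indicatorAt S j.castSucc x = indicatorAt S j.succ y :=
    indicatorAt_congr (x := ⟨j.castSucc, ⟨x, hx⟩⟩) (y := ⟨j.succ, ⟨y, hy⟩⟩) (hS ⟨x, hx⟩ ⟨y, hy⟩ h)
  have hbot (x y : ℕ) (hx : x < T.width j.castSucc) (hy : y < T.width j.castSucc)
      (h : (s.flat j).Bottom (T.bars j) x y) :
      indicatorAt S j.castSucc x = indicatorAt S j.castSucc y :=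
    indicatorAt_congr (x := ⟨j.castSucc, ⟨x, hx⟩⟩) (y := ⟨j.castSucc, ⟨y, hy⟩⟩)
      (hS' ⟨x, hx⟩ ⟨y, hy⟩ h)
  have htop (x y : ℕ) (hx : x < T.width j.succ) (hy : y < T.width j.succ)
      (h : (s.flat j).Top (T.bars j) x y) :
      indicatorAt S j.succ x = indicatorAt S j.succ y :=
    indicatorAt_congr (x := ⟨j.succ, ⟨x, hx⟩⟩) (y := ⟨j.succ, ⟨y, hy⟩⟩) (hS'' ⟨x, hx⟩ ⟨y, hy⟩ h)
  -- The two ends of a cap or a cup both belong to `S` or both do not, so they cancel modulo 2; the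
  -- remaining positions are matched by the vertical strands.
  have hcross (hfit : T.bars j + 2 ≤ T.width j.castSucc ∧ T.width j.succ = T.width j.castSucc)
      (hf : s.flat j = .vert ∨ s.flat j = .horiz) : parity S j.castSucc = parity S j.succ := by
    obtain ⟨hp, hw⟩ := hfit
    rcases hf with hf | hf <;> rw [hf] at hthrough hbot htop <;> unfold parity
    · rw [hw]
      exact Finset.sum_congr rfl fun i hi => hthrough i i (Finset.mem_range.1 hi)
        (hw ▸ Finset.mem_range.1 hi) rfl
    · obtain ⟨n, hn⟩ := Nat.exists_eq_add_of_le' (le_trans (Nat.le_add_left 2 _) hp)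
      rw [hw, hn, sum_range_add_two_of_eq _ (T.bars j) n (by omega)
          (hbot _ _ (by omega) (by omega) ⟨rfl, rfl⟩),
        sum_range_add_two_of_eq _ (T.bars j) n (by omega)
          (htop _ _ (by omega) (by omega) ⟨rfl, rfl⟩)]
      refine Finset.sum_congr rfl fun i hi => ?_
      have hi := Finset.mem_range.1 hi
      split_ifs with h
      · exact hthrough _ _ (by omega) (by omega) ⟨rfl, Or.inl h⟩
      · exact hthrough _ _ (by omega) (by omega) ⟨rfl, Or.inr (by omega)⟩
  have hfit := T.fits j
  rcases hl : T.layer j with _ | _ | _ | _ <;> rw [hl] at hfit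
  · refine hcross hfit ?_
    simp only [Smoothing.flat, hl, dite_true]
    split_ifs <;> simp
  · refine hcross hfit ?_
    simp only [Smoothing.flat, hl, reduceCtorEq, dite_true, dite_false]
    split_ifs <;> simp
  · obtain ⟨hp, hw⟩ : T.bars j + 2 ≤ _ ∧ _ + 2 = T.width j.castSucc := hfit
    have hf : s.flat j = .cap := by simp [Smoothing.flat, hl]
    rw [hf] at hthrough hbot
    unfold parity
    rw [← hw, sum_range_add_two_of_eq _ (T.bars j) _ (by omega)
      (hbot _ _ (by omega) (by omega) ⟨rfl, rfl⟩)]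
    refine Finset.sum_congr rfl fun i hi => ?_
    have hi := Finset.mem_range.1 hi
    split_ifs with h
    · exact hthrough _ _ (by omega) hi (Or.inl ⟨h, rfl⟩)
    · exact hthrough _ _ (by omega) hi (Or.inr ⟨by omega, rfl⟩)
  · obtain ⟨hp, hw⟩ : T.bars j ≤ T.width j.castSucc ∧ T.width j.succ = _ + 2 := hfit
    have hf : s.flat j = .cup := by simp [Smoothing.flat, hl]
    rw [hf] at hthrough htop
    unfold parity
    rw [hw, sum_range_add_two_of_eq _ (T.bars j) _ (by omega)
      (htop _ _ (by omega) (by omega) ⟨rfl, rfl⟩)]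
    refine Finset.sum_congr rfl fun i hi => ?_
    have hi := Finset.mem_range.1 hi
    split_ifs with h
    · exact hthrough _ _ hi (by omega) (Or.inl ⟨h, rfl⟩)
    · exact hthrough _ _ hi (by omega) (Or.inr ⟨by omega, rfl⟩)

/-! ## Loops below a crossing -/

namespace Smoothing

variable {s s' : T.Smoothing} {j : T.Crossing}

/-- The component through the lower nodes of the crossing `j` is a loop that lies below the middle
of the layer of `j`. -/
def LowLoop (s : T.Smoothing) (j : T.Crossing) : Prop :=
  ¬ s.diagram.IsArc (s.cls j.bl) ∧ ∀ z, s.cls z = s.cls j.bl → z.1.1 ≤ j.1.1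

theorem LowLoop.cls_tl_ne (hl : s.LowLoop j) : s.cls j.tl ≠ s.cls j.bl := by
  intro h
  have : j.1.1 + 1 ≤ j.1.1 := hl.2 _ h
  omega

/-- The two lower nodes of a crossing are joined below the crossing if their component is a loop
below the crossing. -/
theorem IsPair.cls_bl_eq_cls_br (h : IsPair s s' j) (hl : s.LowLoop j) :
    s'.cls j.bl = s'.cls j.br := by
  -- If the lower nodes were not joined in `s'`, then `S` would contain `j.bl` but not `j.br`. Below
  -- the crossing the two smoothings agree, so the parity of `S` is constant there; it vanishes at
  -- the bottom line, which no loop meets.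
  let S : Set T.Node := {z | s.cls z = s.cls j.bl ∧ s'.cls z = s'.cls j.bl}
  by_contra hne
  have hpar (k : Fin (T.len + 1)) : k.1 ≤ j.1.1 → parity S k = 0 := by
    induction k using Fin.induction with
    | zero => exact fun _ => parity_eq_zero fun x hx h0 => hl.1 (hx.1 ▸ isArc_of_zero h0)
    | succ k ih =>
      intro hk
      rw [Fin.val_succ] at hk
      have hk' : k ≠ j.1 := fun e => by subst e; omega
      have closed (x y : T.Node) (hxy : s.Joined x y) (hxy' : s'.Joined x y) : x ∈ S ↔ y ∈ S := by
        change _ ∧ _ ↔ _ ∧ _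
        rw [cls_eq_of_joined hxy, cls_eq_of_joined hxy']
      rw [← parity_castSucc_eq_parity_succ s S k, ih (by simp; omega)]
      · exact fun x y hxy => closed _ _ (.through k x y hxy) (.through k x y (h.other k hk' ▸ hxy))
      · exact fun x y hxy => closed _ _ (.bottom k x y hxy) (.bottom k x y (h.other k hk' ▸ hxy))
      · exact fun x y hxy => closed _ _ (.top k x y hxy) (.top k x y (h.other k hk' ▸ hxy))
  have hp := j.fits
  have hj := hpar j.1.castSucc le_rfl
  rw [parity, Finset.sum_eq_single_of_mem (T.bars j.1) (Finset.mem_range.2 (by omega)),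
    indicatorAt, if_pos ⟨by omega, rfl, rfl⟩] at hj
  · exact one_ne_zero hj
  · intro i hi hi'
    refine if_neg ?_
    rintro ⟨hi, hx, hx'⟩
    -- At the lower height of the crossing, `j.bl` is the only node of `S`: `j.br` is excluded by
    -- assumption, and any other string runs on to the upper height, which the low loop does not
    -- reach. So the parity is 1, a contradiction.
    by_cases h1 : i = T.bars j.1 + 1
    · subst h1
      exact hne hx'.symm
    · have : s.Joined ⟨j.1.castSucc, ⟨i, hi⟩⟩ ⟨j.1.succ, ⟨i, hp.2 ▸ hi⟩⟩ :=
        .through j.1 _ _ (by rw [h.horiz]; exact ⟨rfl, by simp only; omega⟩)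
      have : j.1.1 + 1 ≤ j.1.1 := hl.2 _ ((cls_eq_of_joined this).symm.trans hx)
      omega

/-! ### Comparing the components of a horizontal and a vertical smoothing -/

/-- Each horizontal segment joins nodes already connected in `s'`: the lower two by the parity
argument, the upper two via the vertical strands and the lower two. So the components of `s'` are
those of the saddle. -/
theorem IsPair.eq_of_joined (h : IsPair s s' j) (hl : s.LowLoop j) {α : Type} (f : T.Node → α)
    (hf : ∀ x y, s'.Joined x y → f x = f y) : ∀ x y, s.Joined x y → f x = f y := by
  have hbr : f j.bl = f j.br := eq_of_cls_eq f hf (h.cls_bl_eq_cls_br hl)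
  intro x y hxy
  rcases h.joined_horiz hxy with h' | ⟨rfl, rfl⟩ | ⟨rfl, rfl⟩
  · exact hf _ _ h'
  · exact hbr
  · rw [← hf _ _ h.joined_left, ← hf _ _ h.joined_right, hbr]

theorem IsPair.cls_eq_of_cls_eq (h : IsPair s s' j) (hl : s.LowLoop j) {x y : T.Node}
    (hxy : s.cls x = s.cls y) : s'.cls x = s'.cls y :=
  eq_of_cls_eq s'.cls (h.eq_of_joined hl s'.cls fun _ _ => cls_eq_of_joined) hxy

theorem IsPair.sad_eq_iff (h : IsPair s s' j) (hl : s.LowLoop j) {x y : T.Node} :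
    sad s s' x = sad s s' y ↔ s'.cls x = s'.cls y :=
  ⟨eq_of_sad_eq s'.cls (h.eq_of_joined hl s'.cls fun _ _ => cls_eq_of_joined)
    fun _ _ => cls_eq_of_joined, sad_eq_of_cls_eq'⟩

theorem IsPair.sad_eq_iff' (h : IsPair s s' j) (hl : s.LowLoop j) {x y : T.Node} :
    sad s' s x = sad s' s y ↔ s'.cls x = s'.cls y :=
  ⟨eq_of_sad_eq s'.cls (fun _ _ => cls_eq_of_joined)
    (h.eq_of_joined hl s'.cls fun _ _ => cls_eq_of_joined), sad_eq_of_cls_eq⟩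

/-- In the vertical smoothing, the lower loop is merged with the component above it. -/
theorem IsPair.cls_of_mem_loop (h : IsPair s s' j) (hl : s.LowLoop j) {x : T.Node}
    (hx : s.cls x = s.cls j.bl) : s'.cls x = s'.cls j.tl :=
  (h.cls_eq_of_cls_eq hl hx).trans (cls_eq_of_joined h.joined_left)

/-- The other components are the same in both smoothings. -/
theorem IsPair.cls_eq_iff (h : IsPair s s' j) (hl : s.LowLoop j) {x y : T.Node}
    (hx : s.cls x ≠ s.cls j.bl) (hy : s.cls y ≠ s.cls j.bl) :
    s'.cls x = s'.cls y ↔ s.cls x = s.cls y := by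
  classical
  refine ⟨fun hxy => ?_, h.cls_eq_of_cls_eq hl⟩
  have hbr : s.cls j.br = s.cls j.bl := (cls_eq_of_joined h.joined_bottom).symm
  have htr : s.cls j.tr = s.cls j.tl := (cls_eq_of_joined h.joined_top).symm
  -- Relabelling the low loop by the component above it gives a function constant along the two
  -- vertical strands, hence on the components of `s'`.
  have := eq_of_cls_eq (fun z => if s.cls z = s.cls j.bl then s.cls j.tl else s.cls z)
    (fun a b hab => ?_) hxy
  · simpa [hx, hy] using this
  · rcases h.joined_vert hab with h' | ⟨rfl, rfl⟩ | ⟨rfl, rfl⟩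
    · simp only [cls_eq_of_joined h']
    · simp [hl.cls_tl_ne]
    · simp [hbr, htr, hl.cls_tl_ne]

theorem LowLoop.endNode_ne (hl : s.LowLoop j) (p : T.Endpoint) :
    s.cls (T.endNode p) ≠ s.cls j.bl :=
  fun e => hl.1 ⟨p, e⟩

theorem IsPair.isArc_iff (h : IsPair s s' j) (hl : s.LowLoop j) {x : T.Node}
    (hx : s.cls x ≠ s.cls j.bl) :
    s'.diagram.IsArc (s'.cls x) ↔ s.diagram.IsArc (s.cls x) := by
  simp only [isArc_cls_iff, h.cls_eq_iff hl (hl.endNode_ne _) hx]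

end Smoothing
end MorsePresentation
end TangleMorse

namespace TangleMorse
namespace MorsePresentation

open Smoothing

variable {T : MorsePresentation}

/-! ## Matrix elements of the delooped complex -/

namespace Cell

variable {a b : T.Cell}

/-- The node `x` lies on a red loop. -/
def RedAt (a : T.Cell) (x : T.Node) : Prop := ∃ l ∈ a.red, l.1 = a.smoothing.cls x

theorem redAt_congr {x y : T.Node} (h : a.smoothing.cls x = a.smoothing.cls y) :
    a.RedAt x ↔ a.RedAt y := by rw [RedAt, RedAt, h]

theorem RedAt.not_isArc {x : T.Node} (h : a.RedAt x) :
    ¬ a.smoothing.diagram.IsArc (a.smoothing.cls x) := by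
  obtain ⟨l, -, hl⟩ := h
  exact hl ▸ l.2

theorem redAt_iff_mem {x : T.Node} (l : a.smoothing.diagram.Loop)
    (h : l.1 = a.smoothing.cls x) : a.RedAt x ↔ l ∈ a.red := by
  refine ⟨?_, fun hl => ⟨l, hl, h⟩⟩
  rintro ⟨l', hl', h'⟩
  rwa [Subtype.ext (h.trans h'.symm)]

theorem ext_of_redAt (hs : a.smoothing = b.smoothing) (h : ∀ x, a.RedAt x ↔ b.RedAt x) :
    a = b := by
  obtain ⟨s, r⟩ := a
  obtain ⟨s', r'⟩ := b
  obtain rfl : s = s' := hs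
  congr 1
  ext l
  obtain ⟨x, hx⟩ := cls_surjective l.1
  rw [← redAt_iff_mem (a := ⟨s, r⟩) l hx.symm, h, redAt_iff_mem (a := ⟨s, r'⟩) l hx.symm]

/-- The cobordism underlying a matrix element of the delooped complex. -/
noncomputable def surface (a b : T.Cell) : Surface a.obj b.obj :=
  ((Surface.deloopInv a.smoothing.diagram a.red).comp (saddle a.smoothing b.smoothing)).comp
    (Surface.deloopHom b.smoothing.diagram b.red)

theorem changes_unique {s s' : T.Smoothing} {j k : T.Crossing} (hj : s.Changes s' j)
    (hk : s.Changes s' k) : k = j := by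
  by_contra h
  have := hj.2.2 k h
  rw [hk.1, hk.2.1] at this
  exact one_ne_zero this

theorem d_eq_single {j : T.Crossing} (h : a.smoothing.Changes b.smoothing j) :
    ∃ u : ℤ, u * u = 1 ∧ Cell.d a b = Finsupp.single (surface a b) u := by
  classical
  refine ⟨(-1) ^ Nat.card {k : T.Crossing // k.1 < j.1 ∧ a.smoothing k = 1}, ?_, ?_⟩
  · rw [← mul_pow]
    simp
  · have hd : Smoothing.d a.smoothing b.smoothing = Finsupp.single
        (saddle a.smoothing b.smoothing)
        ((-1) ^ Nat.card {k : T.Crossing // k.1 < j.1 ∧ a.smoothing k = 1}) := by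
      rw [Smoothing.d, Finset.sum_eq_single j]
      · exact if_pos h
      · exact fun k _ hk => if_neg fun h' => hk (changes_unique h h')
      · simp
    rw [Cell.d, hd, Mor.of, Mor.of, Mor.comp_single, Mor.comp_single, one_mul, mul_one]
    rfl

theorem exists_changes (h : Cell.d a b ∉ Mor.rel a.obj b.obj) :
    ∃ j, a.smoothing.Changes b.smoothing j := by
  classical
  by_contra hne
  push Not at hne
  refine h ?_
  have hd : Smoothing.d a.smoothing b.smoothing = 0 :=
    Finset.sum_eq_zero fun j _ => if_neg (hne j)
  rw [Cell.d, hd, Mor.comp_zero, Mor.zero_comp]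
  exact zero_mem _

/-- The cobordism underlying a matrix element with discs glued to all loops. -/
noncomputable def capped (a b : T.Cell) : Surface a.obj b.obj :=
  (saddle a.smoothing b.smoothing).delooped a.red b.red

theorem surface_homeo_capped (a b : T.Cell) : (surface a b).Homeo (capped a b) :=
  Surface.comp_homeo_delooped _ _ _

theorem capped_dots (a b : T.Cell) (q : (saddle a.smoothing b.smoothing).Comp) :
    (capped a b).dots q = Nat.card {l : a.smoothing.diagram.Loop // l ∈ a.redᶜ ∧
        (saddle a.smoothing b.smoothing).src l.1 = q}
      + Nat.card {l : b.smoothing.diagram.Loop // l ∈ b.red ∧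
        (saddle a.smoothing b.smoothing).tgt l.1 = q} :=
  congrArg (· + _) (zero_add _)

/-- A saddle component without endpoints becomes a sphere once all loops are capped, since the
saddle has genus zero. -/
theorem capped_dots_eq_one (h : Cell.d a b ∉ Mor.rel a.obj b.obj)
    {q : (saddle a.smoothing b.smoothing).Comp}
    (hq : ∀ p, sad a.smoothing b.smoothing (T.endNode p) ≠ q) : (capped a b).dots q = 1 := by
  obtain ⟨j, hj⟩ := exists_changes h
  obtain ⟨u, -, hu⟩ := d_eq_single hj
  rw [hu] at h
  have h' : Mor.of (capped a b) ∉ Mor.rel a.obj b.obj := fun hc =>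
    Mor.of_not_mem_rel_of_single h (Surface.of_mem_rel_of_homeo (surface_homeo_capped a b) hc)
  refine Surface.dots_of_not_mem_rel h' (s := q) ⟨?_, ?_⟩ rfl
  · rintro ⟨_, p, rfl⟩
    exact hq p
  · rintro ⟨_, p, rfl⟩
    exact hq p

theorem card_loops_eq {s : T.Smoothing} (r : Set s.diagram.Loop) (l : s.diagram.Loop)
    (Q : s.diagram.Comp → Prop) (hQ : Q l.1) (h : ∀ l' ∈ r, Q l'.1 → l' = l) :
    (l ∈ r → Nat.card {l : s.diagram.Loop // l ∈ r ∧ Q l.1} = 1) ∧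
      (l ∉ r → Nat.card {l : s.diagram.Loop // l ∈ r ∧ Q l.1} = 0) := by
  refine ⟨fun hl => ?_, fun hl => ?_⟩
  · exact Nat.card_eq_one_iff_unique.2 ⟨⟨fun x y => Subtype.ext
      ((h _ x.2.1 x.2.2).trans (h _ y.2.1 y.2.2).symm)⟩, ⟨⟨l, hl, hQ⟩⟩⟩
  · refine Nat.card_eq_zero.2 (Or.inl ⟨fun x => hl ?_⟩)
    rw [← h _ x.2.1 x.2.2]
    exact x.2.1

/-- The colour of a loop is preserved along a non-zero matrix element if no other loop in the same
component of the saddle contributes a dot. -/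
theorem redAt_iff_of_local (h : Cell.d a b ∉ Mor.rel a.obj b.obj) {x : T.Node}
    (ha : ∀ y, ¬ a.RedAt y → sad a.smoothing b.smoothing y = sad a.smoothing b.smoothing x →
      a.smoothing.cls y = a.smoothing.cls x)
    (hb : ∀ y, b.RedAt y → sad a.smoothing b.smoothing y = sad a.smoothing b.smoothing x →
      b.smoothing.cls y = b.smoothing.cls x)
    (hab : b.smoothing.diagram.IsArc (b.smoothing.cls x) ↔
      a.smoothing.diagram.IsArc (a.smoothing.cls x)) : a.RedAt x ↔ b.RedAt x := by
  by_cases hx : a.smoothing.diagram.IsArc (a.smoothing.cls x)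
  · exact ⟨fun h => absurd hx h.not_isArc, fun h => absurd (hab.2 hx) h.not_isArc⟩
  -- Nodes on arcs are never red, so `ha` applies to endpoints: an endpoint in this saddle component
  -- would turn the loop through `x` into an arc.
  have hq : ∀ p, sad a.smoothing b.smoothing (T.endNode p) ≠ sad a.smoothing b.smoothing x :=
    fun p hp => hx ⟨p, ha _ (fun hr => hr.not_isArc ⟨p, rfl⟩) hp⟩
  have hd := capped_dots_eq_one h hq
  let la : a.smoothing.diagram.Loop := ⟨a.smoothing.cls x, hx⟩
  let lb : b.smoothing.diagram.Loop := ⟨b.smoothing.cls x, mt hab.1 hx⟩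
  obtain ⟨a1, a0⟩ := card_loops_eq a.redᶜ la (fun c => (saddle a.smoothing b.smoothing).src c =
    sad a.smoothing b.smoothing x) rfl (by
      intro l hl hQ
      obtain ⟨y, hy⟩ := cls_surjective l.1
      refine Subtype.ext (hy.symm.trans (ha y ?_ (by rw [← hQ, ← hy]; rfl)))
      rwa [redAt_iff_mem l hy.symm])
  obtain ⟨b1, b0⟩ := card_loops_eq b.red lb (fun c => (saddle a.smoothing b.smoothing).tgt c =
    sad a.smoothing b.smoothing x) rfl (by
      intro l hl hQ
      obtain ⟨y, hy⟩ := cls_surjective l.1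
      refine Subtype.ext (hy.symm.trans (hb y ?_ (by rw [← hQ, ← hy]; rfl)))
      rwa [redAt_iff_mem l hy.symm])
  -- The single dot of the sphere comes either from the loop in `a` being blue or from the loop in
  -- `b` being red, and not from both. So the colours agree.
  rw [capped_dots] at hd
  rw [redAt_iff_mem la rfl, redAt_iff_mem lb rfl]
  by_cases h1 : la ∈ a.red <;> by_cases h2 : lb ∈ b.red
  · simp [h1, h2]
  · have := a0 (by simpa using h1)
    have := b0 h2
    omega
  · have := a1 (by simpa using h1)
    have := b1 h2
    omega
  · simp [h1, h2]

/-- Loops which do not meet the crossing keep their colour. -/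
theorem redAt_iff_of_avoids (h : Cell.d a b ∉ Mor.rel a.obj b.obj) {j : T.Crossing}
    (hj : a.smoothing.Changes b.smoothing j) {x : T.Node} (hx : a.smoothing.Avoids j x) :
    a.RedAt x ↔ b.RedAt x := by
  obtain ⟨h1, h2⟩ := hj.agreeOff
  exact redAt_iff_of_local h (fun y _ hy => hx.sad_eq h2 hy)
    (fun y _ hy => hx.cls_eq h1 (hx.sad_eq h2 hy)) (hx.isArc_iff h1 h2)

/-! ### Matrix elements that merge or split out a loop below the crossing -/

/-- On the nodes in `G`, the components of both smoothings agree with those of the saddle, and the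
other nodes lie on components which meet `G` or do not contribute a dot to the delooped saddle. -/
structure IsTidy (a b : T.Cell) (G : Set T.Node) : Prop where
  endNode : ∀ p, T.endNode p ∈ G
  left : ∀ x ∈ G, ∀ y ∈ G, sad a.smoothing b.smoothing x = sad a.smoothing b.smoothing y →
    a.smoothing.cls x = a.smoothing.cls y
  right : ∀ x ∈ G, ∀ y ∈ G, sad a.smoothing b.smoothing x = sad a.smoothing b.smoothing y →
    b.smoothing.cls x = b.smoothing.cls y
  left_rep : ∀ y, ¬ a.RedAt y → ∃ x ∈ G, a.smoothing.cls x = a.smoothing.cls y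
  right_rep : ∀ y, b.RedAt y → ∃ x ∈ G, b.smoothing.cls x = b.smoothing.cls y

namespace IsTidy

variable {G : Set T.Node} (hG : IsTidy a b G)
include hG

theorem cls_left {x y : T.Node} (hx : x ∈ G) (hy : ¬ a.RedAt y)
    (h : sad a.smoothing b.smoothing y = sad a.smoothing b.smoothing x) :
    a.smoothing.cls y = a.smoothing.cls x := by
  obtain ⟨z, hz, hzy⟩ := hG.left_rep y hy
  rw [← hzy]
  exact hG.left z hz x hx ((sad_eq_of_cls_eq hzy).trans h)

theorem cls_right {x y : T.Node} (hx : x ∈ G) (hy : b.RedAt y)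
    (h : sad a.smoothing b.smoothing y = sad a.smoothing b.smoothing x) :
    b.smoothing.cls y = b.smoothing.cls x := by
  obtain ⟨z, hz, hzy⟩ := hG.right_rep y hy
  rw [← hzy]
  exact hG.right z hz x hx ((sad_eq_of_cls_eq' hzy).trans h)

theorem redAt_iff (h : Cell.d a b ∉ Mor.rel a.obj b.obj) {x : T.Node} (hx : x ∈ G) :
    a.RedAt x ↔ b.RedAt x :=
  redAt_iff_of_local h (fun _ => hG.cls_left hx) (fun _ => hG.cls_right hx)
    ⟨fun ⟨p, hp⟩ => ⟨p, hG.left _ (hG.endNode p) x hx (sad_eq_of_cls_eq' hp)⟩,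
      fun ⟨p, hp⟩ => ⟨p, hG.right _ (hG.endNode p) x hx (sad_eq_of_cls_eq hp)⟩⟩

/-- `G` contains all endpoints, so distinct arcs stay in distinct saddle components. A loop
contributing a dot to a strip would have a representative in `G` and hence be an arc. -/
theorem isStrips (h : Cell.d a b ∉ Mor.rel a.obj b.obj) : (capped a b).IsStrips := by
  have hr1 : Set.range (capped a b).src =
      Set.range fun p => sad a.smoothing b.smoothing (T.endNode p) := by
    ext q
    constructor
    · rintro ⟨⟨_, p, rfl⟩, rfl⟩
      exact ⟨p, rfl⟩
    · rintro ⟨p, rfl⟩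
      exact ⟨⟨_, p, rfl⟩, rfl⟩
  have hr2 : Set.range (capped a b).tgt =
      Set.range fun p => sad a.smoothing b.smoothing (T.endNode p) := by
    ext q
    constructor
    · rintro ⟨⟨_, p, rfl⟩, rfl⟩
      exact ⟨p, rfl⟩
    · rintro ⟨p, rfl⟩
      exact ⟨⟨_, p, rfl⟩, rfl⟩
  refine ⟨?_, ?_, hr1.trans hr2.symm, fun _ => rfl, ?_, ?_⟩
  · rintro ⟨_, p, rfl⟩ ⟨_, p', rfl⟩ hpp
    exact Subtype.ext (hG.left _ (hG.endNode p) _ (hG.endNode p') hpp)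
  · rintro ⟨_, p, rfl⟩ ⟨_, p', rfl⟩ hpp
    exact Subtype.ext (hG.right _ (hG.endNode p) _ (hG.endNode p') hpp)
  · rw [hr1]
    rintro _ ⟨p, rfl⟩
    refine (capped_dots a b _).trans (Nat.add_eq_zero_iff.2
      ⟨Nat.card_eq_zero.2 (Or.inl ⟨?_⟩), Nat.card_eq_zero.2 (Or.inl ⟨?_⟩)⟩)
    · rintro ⟨l, hl, hQ⟩
      obtain ⟨y, hy⟩ := cls_surjective l.1
      have hy' : ¬ a.RedAt y := by rwa [redAt_iff_mem l hy.symm]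
      refine l.2 ⟨p, ?_⟩
      rw [← hy]
      exact (hG.cls_left (hG.endNode p) hy'
        ((congrArg (saddle a.smoothing b.smoothing).src hy).trans hQ)).symm
    · rintro ⟨l, hl, hQ⟩
      obtain ⟨y, hy⟩ := cls_surjective l.1
      have hy' : b.RedAt y := by rwa [redAt_iff_mem l hy.symm]
      refine l.2 ⟨p, ?_⟩
      rw [← hy]
      exact (hG.cls_right (hG.endNode p) hy'
        ((congrArg (saddle a.smoothing b.smoothing).tgt hy).trans hQ)).symm
  · rw [hr1]
    intro q hq
    exact capped_dots_eq_one h fun p hp => hq ⟨p, hp⟩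

theorem isIso (h : Cell.d a b ∉ Mor.rel a.obj b.obj) {o : T.Orientation}
    (hs : a.shift o = b.shift o) : Cell.IsIso o a b := by
  obtain ⟨j, hj⟩ := exists_changes h
  obtain ⟨u, hu, hd⟩ := d_eq_single hj
  rw [Cell.IsIso, hd, hs]
  refine Mor.isIso_single_of_isStrips ?_ (fun x => ?_) (fun x => ?_) hu _
  · obtain ⟨e, h1, h2, h3, h4⟩ := (surface_homeo_capped a b).symm
    exact (hG.isStrips h).of_homeo ⟨e, h1, h2, h3, h4⟩
  · obtain ⟨_, p, rfl⟩ := x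
    exact ⟨p, rfl⟩
  · obtain ⟨_, p, rfl⟩ := x
    exact ⟨p, rfl⟩

end IsTidy

/-- The edge changes the smoothing at `j`, and it merges a red loop or splits out a blue loop that
lies below the middle of the layer of `j`. -/
def IsKey (a b : T.Cell) (j : T.Crossing) : Prop :=
  (T.layer j.1 = .neg ∧ IsPair a.smoothing b.smoothing j ∧ a.smoothing.LowLoop j ∧ a.RedAt j.bl) ∨
    (T.layer j.1 = .pos ∧ IsPair b.smoothing a.smoothing j ∧ b.smoothing.LowLoop j ∧
      ¬ b.RedAt j.bl)

/-- Only the low loop is left out. It is red, so the inverse of delooping puts no dot on it, and in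
`b` it is represented by the node `j.tl` above the crossing. -/
theorem isTidy_of_neg {j : T.Crossing} (h : IsPair a.smoothing b.smoothing j)
    (hl : a.smoothing.LowLoop j) (hr : a.RedAt j.bl) :
    IsTidy a b {x | a.smoothing.cls x ≠ a.smoothing.cls j.bl} where
  endNode := hl.endNode_ne
  left x hx y hy hxy := (h.cls_eq_iff hl hx hy).1 ((h.sad_eq_iff hl).1 hxy)
  right x hx y hy hxy := (h.sad_eq_iff hl).1 hxy
  left_rep y hy := ⟨y, fun e => hy ((redAt_congr e).2 hr), rfl⟩
  right_rep y _ := by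
    by_cases hy : a.smoothing.cls y = a.smoothing.cls j.bl
    · exact ⟨j.tl, hl.cls_tl_ne, (h.cls_of_mem_loop hl hy).symm⟩
    · exact ⟨y, hy, rfl⟩

/-- The mirror image: the low loop is split out and blue, so delooping the target puts no dot on it.
-/
theorem isTidy_of_pos {j : T.Crossing} (h : IsPair b.smoothing a.smoothing j)
    (hl : b.smoothing.LowLoop j) (hr : ¬ b.RedAt j.bl) :
    IsTidy a b {x | b.smoothing.cls x ≠ b.smoothing.cls j.bl} where
  endNode := hl.endNode_ne
  left x hx y hy hxy := (h.sad_eq_iff' hl).1 hxy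
  right x hx y hy hxy := (h.cls_eq_iff hl hx hy).1 ((h.sad_eq_iff' hl).1 hxy)
  left_rep y _ := by
    by_cases hy : b.smoothing.cls y = b.smoothing.cls j.bl
    · exact ⟨j.tl, hl.cls_tl_ne, (h.cls_of_mem_loop hl hy).symm⟩
    · exact ⟨y, hy, rfl⟩
  right_rep y hy := ⟨y, fun e => hr ((redAt_congr e).1 hy), rfl⟩

/-! ### Degrees -/

/-- The low loop is the only component of `s` without a counterpart of its own in `s'`. Applied to
the loops and to the red loops, this gives the change of the quantum shift. -/
theorem ncard_image_cls {s s' : T.Smoothing} {j : T.Crossing} (h : IsPair s s' j)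
    (hl : s.LowLoop j) (φ φ' : T.Node → Prop)
    (hφ : ∀ x y, s.cls x = s.cls y → (φ x ↔ φ y)) (hφ' : ∀ x y, s'.cls x = s'.cls y → (φ' x ↔ φ' y))
    (hφφ : ∀ x, s.cls x ≠ s.cls j.bl → (φ x ↔ φ' x)) [Decidable (φ j.bl)] :
    (s.cls '' {x | φ x}).ncard = (s'.cls '' {x | φ' x}).ncard + if φ j.bl then 1 else 0 := by
  let G : Set T.Node := {x | s.cls x ≠ s.cls j.bl ∧ φ x}
  have hV : s'.cls '' {x | φ' x} = s'.cls '' G := by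
    apply Set.Subset.antisymm
    · rintro _ ⟨x, hx, rfl⟩
      by_cases hxl : s.cls x = s.cls j.bl
      · have e := h.cls_of_mem_loop hl hxl
        exact ⟨j.tl, ⟨hl.cls_tl_ne, (hφφ _ hl.cls_tl_ne).2 ((hφ' _ _ e).1 hx)⟩, e.symm⟩
      · exact ⟨x, ⟨hxl, (hφφ x hxl).2 hx⟩, rfl⟩
    · rintro _ ⟨x, ⟨hx, hx'⟩, rfl⟩
      exact ⟨x, (hφφ x hx).1 hx', rfl⟩
  have hVH : (s'.cls '' G).ncard = (s.cls '' G).ncard := by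
    let f : s.diagram.Comp → s'.diagram.Comp :=
      Quot.lift s'.cls (fun x y hxy => h.cls_eq_of_cls_eq hl (cls_eq_of_joined hxy))
    have hf : s'.cls '' G = f '' (s.cls '' G) := by
      rw [Set.image_image]
      rfl
    rw [hf]
    refine Set.InjOn.ncard_image ?_
    rintro _ ⟨x, hx, rfl⟩ _ ⟨y, hy, rfl⟩ hxy
    exact (h.cls_eq_iff hl hx.1 hy.1).1 hxy
  rw [hV, hVH]
  split_ifs with hbl
  · have : s.cls '' {x | φ x} = insert (s.cls j.bl) (s.cls '' G) := by
      apply Set.Subset.antisymm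
      · rintro _ ⟨x, hx, rfl⟩
        by_cases hxl : s.cls x = s.cls j.bl
        · exact Or.inl hxl
        · exact Or.inr ⟨x, ⟨hxl, hx⟩, rfl⟩
      · rintro _ (rfl | ⟨x, hx, rfl⟩)
        · exact ⟨_, hbl, rfl⟩
        · exact ⟨x, hx.2, rfl⟩
    rw [this, Set.ncard_insert_of_notMem]
    rintro ⟨x, hx, hx'⟩
    exact hx.1 hx'
  · rw [add_zero]
    congr 1
    apply Set.Subset.antisymm
    · rintro _ ⟨x, hx, rfl⟩
      exact ⟨x, ⟨fun e => hbl ((hφ _ _ e).1 hx), hx⟩, rfl⟩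
    · rintro _ ⟨x, hx, rfl⟩
      exact ⟨x, hx.2, rfl⟩

theorem card_loop_eq_ncard (s : T.Smoothing) : Nat.card s.diagram.Loop =
    (s.cls '' {x | ¬ s.diagram.IsArc (s.cls x)}).ncard := by
  rw [show s.cls '' {x | ¬ s.diagram.IsArc (s.cls x)} = {c | ¬ s.diagram.IsArc c} from ?_]
  · exact Nat.card_coe_set_eq _
  · apply Set.Subset.antisymm
    · rintro _ ⟨x, hx, rfl⟩
      exact hx
    · intro c hc
      obtain ⟨x, rfl⟩ := cls_surjective c
      exact ⟨x, hc, rfl⟩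

theorem ncard_red_eq (a : T.Cell) : a.red.ncard = (a.smoothing.cls '' {x | a.RedAt x}).ncard := by
  rw [← Set.ncard_image_of_injective a.red Subtype.val_injective]
  congr 1
  apply Set.Subset.antisymm
  · rintro _ ⟨l, hl, rfl⟩
    obtain ⟨x, hx⟩ := cls_surjective l.1
    exact ⟨x, ⟨l, hl, hx.symm⟩, hx⟩
  · rintro _ ⟨x, ⟨l, hl, hx⟩, rfl⟩
    exact ⟨l, hl, hx⟩

theorem ones_of_changes {s s' : T.Smoothing} {j : T.Crossing} (h : s.Changes s' j) :
    s'.ones = s.ones + 1 := by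
  have : {k | s' k = 1} = insert j {k | s k = 1} := by
    ext k
    by_cases hk : k = j
    · subst hk
      simp [h.2.1]
    · simp [hk, h.2.2 k hk]
  have h1 : s'.ones = {k | s' k = 1}.ncard := Nat.card_coe_set_eq _
  have h2 : s.ones = {k | s k = 1}.ncard := Nat.card_coe_set_eq _
  rw [h1, h2, this, Set.ncard_insert_of_notMem]
  simp [h.1]

theorem card_loop_of_isPair {s s' : T.Smoothing} {j : T.Crossing} (h : IsPair s s' j)
    (hl : s.LowLoop j) : Nat.card s.diagram.Loop = Nat.card s'.diagram.Loop + 1 := by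
  classical
  rw [card_loop_eq_ncard, card_loop_eq_ncard, ncard_image_cls h hl
    (fun x => ¬ s.diagram.IsArc (s.cls x)) (fun x => ¬ s'.diagram.IsArc (s'.cls x))
    (fun x y e => by rw [e]) (fun x y e => by rw [e]) (fun x hx => by rw [h.isArc_iff hl hx]),
    if_pos hl.1]

theorem IsKey.redAt_iff {j : T.Crossing} (hk : IsKey a b j)
    (h : Cell.d a b ∉ Mor.rel a.obj b.obj) :
    (T.layer j.1 = .neg → ∀ x, a.smoothing.cls x ≠ a.smoothing.cls j.bl → (a.RedAt x ↔ b.RedAt x)) ∧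
    (T.layer j.1 = .pos → ∀ x, b.smoothing.cls x ≠ b.smoothing.cls j.bl →
      (a.RedAt x ↔ b.RedAt x)) := by
  rcases hk with ⟨hj, hp, hl, hr⟩ | ⟨hj, hp, hl, hr⟩
  · exact ⟨fun _ x hx => (isTidy_of_neg hp hl hr).redAt_iff h hx, fun h' => by simp [hj] at h'⟩
  · exact ⟨fun h' => by simp [hj] at h', fun _ x hx => (isTidy_of_pos hp hl hr).redAt_iff h hx⟩

/-- The shifts agree: the additional 1-smoothing contributes 1. Losing a red loop contributes `-2 +
1`, and gaining a blue loop contributes `-1`. -/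
theorem IsKey.isIso {j : T.Crossing} (hk : IsKey a b j) (h : Cell.d a b ∉ Mor.rel a.obj b.obj)
    (hj : a.smoothing.Changes b.smoothing j) (o : T.Orientation) : Cell.IsIso o a b := by
  classical
  have hred := hk.redAt_iff h
  have ho := ones_of_changes hj
  rcases hk with ⟨hj, hp, hl, hr⟩ | ⟨hj, hp, hl, hr⟩
  · refine (isTidy_of_neg hp hl hr).isIso h ?_
    have h1 := card_loop_of_isPair hp hl
    have h2 := ncard_image_cls hp hl a.RedAt b.RedAt (fun _ _ => redAt_congr)
      (fun _ _ => redAt_congr) (hred.1 hj)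
    rw [← ncard_red_eq, ← ncard_red_eq, if_pos hr] at h2
    rw [shift, shift, ho, h1, h2]
    push_cast
    ring
  · refine (isTidy_of_pos hp hl hr).isIso h ?_
    have h1 := card_loop_of_isPair hp hl
    have h2 := ncard_image_cls hp hl b.RedAt a.RedAt (fun _ _ => redAt_congr)
      (fun _ _ => redAt_congr) (fun x hx => (hred.2 hj x hx).symm)
    rw [← ncard_red_eq, ← ncard_red_eq, if_neg hr] at h2
    rw [shift, shift, ho, h1, h2]
    push_cast
    ring

/-! ### The numbers `i` and `u` -/

theorem i_eq {j : T.Crossing} (hj : a.smoothing.Changes b.smoothing j) : Cell.i a b = j.1.1 + 1 := by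
  have : {k | ∃ j : T.Crossing, a.smoothing.Changes b.smoothing j ∧ k = j.1.1 + 1} = {j.1.1 + 1} := by
    ext k
    constructor
    · rintro ⟨j', hj', rfl⟩
      rw [changes_unique hj hj']
      rfl
    · rintro rfl
      exact ⟨j, hj, rfl⟩
  rw [Cell.i, this, csInf_singleton]

/-- A loop away from the crossing is the only component of its smoothing in its saddle component, so
it cannot be merged. -/
theorem exists_around_of_merged {j : T.Crossing} (hj : a.smoothing.Changes b.smoothing j)
    {l : a.smoothing.diagram.Loop} (hl : Merged a b l) :
    ∃ z, Around j z ∧ a.smoothing.cls z = l.1 := by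
  obtain ⟨y, hy, hyl⟩ := hl
  obtain ⟨x, hx⟩ := cls_surjective l.1
  obtain ⟨y, rfl⟩ := cls_surjective y
  by_contra hne
  push Not at hne
  have hav : a.smoothing.Avoids j x := fun z hz e => hne z hz (e.trans hx)
  refine hy ((hav.sad_eq hj.agreeOff.2 (z := y) ?_).trans hx)
  exact hyl.trans (congrArg (saddle a.smoothing b.smoothing).src hx.symm)

theorem exists_around_of_splitOut {j : T.Crossing} (hj : a.smoothing.Changes b.smoothing j)
    {l : b.smoothing.diagram.Loop} (hl : SplitOut a b l) :
    ∃ z, Around j z ∧ b.smoothing.cls z = l.1 := by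
  obtain ⟨y, hy, hyl⟩ := hl
  obtain ⟨x, hx⟩ := cls_surjective l.1
  obtain ⟨y, rfl⟩ := cls_surjective y
  by_contra hne
  push Not at hne
  have hav : b.smoothing.Avoids j x := fun z hz e => hne z hz (e.trans hx)
  have hav' := hav.of_agreeOff hj.agreeOff.2 hj.agreeOff.1
  refine hy (Eq.trans (hav'.cls_eq hj.agreeOff.1 (hav'.sad_eq hj.agreeOff.2 (z := y) ?_)) hx)
  exact hyl.trans (congrArg (saddle a.smoothing b.smoothing).tgt hx.symm)

theorem maxLayer_eq_of_lowLoop {s : T.Smoothing} {j : T.Crossing} (hl : s.LowLoop j) :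
    s.maxLayer ⟨s.cls j.bl, hl.1⟩ = j.1.1 + 1 :=
  le_antisymm (maxLayer_le _ _ hl.2) (le_maxLayer _ j.1 j.bl (Or.inl rfl) rfl)

/-- The low loop attains the value `j + 1`. No smaller value occurs, because every loop that is
merged or split out meets the crossing. -/
theorem IsKey.u_eq {j : T.Crossing} (hk : IsKey a b j)
    (hj : a.smoothing.Changes b.smoothing j) : Cell.u a b = j.1.1 + 1 := by
  have hmem : j.1.1 + 1 ∈ {k | ∃ l ∈ a.red, Merged a b l ∧ k = a.smoothing.maxLayer l} ∪
      {k | ∃ l ∉ b.red, SplitOut a b l ∧ k = b.smoothing.maxLayer l} := by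
    rcases hk with ⟨-, hp, hl, hr⟩ | ⟨-, hp, hl, hr⟩
    · refine Or.inl ⟨⟨_, hl.1⟩, (redAt_iff_mem _ rfl).1 hr, ⟨_, hl.cls_tl_ne, ?_⟩,
        (maxLayer_eq_of_lowLoop hl).symm⟩
      exact ((hp.sad_eq_iff hl).2 (hp.cls_of_mem_loop hl rfl)).symm
    · refine Or.inr ⟨⟨_, hl.1⟩, mt (redAt_iff_mem _ rfl).2 hr, ⟨_, hl.cls_tl_ne, ?_⟩,
        (maxLayer_eq_of_lowLoop hl).symm⟩
      exact ((hp.sad_eq_iff' hl).2 (hp.cls_of_mem_loop hl rfl)).symm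
  refine le_antisymm (Nat.sInf_le hmem) (le_csInf ⟨_, hmem⟩ ?_)
  rintro _ (⟨l, -, hl, rfl⟩ | ⟨l, -, hl, rfl⟩)
  · obtain ⟨z, hz, hzl⟩ := exists_around_of_merged hj hl
    exact le_maxLayer l j.1 z hz.height hzl
  · obtain ⟨z, hz, hzl⟩ := exists_around_of_splitOut hj hl
    exact le_maxLayer l j.1 z hz.height hzl

theorem lowLoop_of_maxLayer {s s' : T.Smoothing} {j : T.Crossing} (hp : IsPair s s' j)
    {l : s.diagram.Loop} {z : T.Node} (hz : Around j z) (hzl : s.cls z = l.1)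
    (hl : s.maxLayer l = j.1.1 + 1) : s.LowLoop j ∧ s.cls j.bl = l.1 := by
  have hlow (y : T.Node) (hy : s.cls y = l.1) : y.1.1 ≤ j.1.1 := by
    have := height_lt_maxLayer l y hy
    omega
  have hbl : s.cls j.bl = l.1 := by
    rcases hz with rfl | rfl | rfl | rfl
    · exact hzl
    · exact (cls_eq_of_joined hp.joined_bottom).trans hzl
    · have : j.1.1 + 1 ≤ j.1.1 := hlow _ hzl
      omega
    · have : j.1.1 + 1 ≤ j.1.1 := hlow _ hzl
      omega
  exact ⟨⟨hbl ▸ l.2, fun y hy => hlow y (hy.trans hbl)⟩, hbl⟩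

/-- The vertical strands carry the loop to the top of the layer, and from there it must enter a
higher one. -/
theorem maxLayer_ne_of_vert {s s' : T.Smoothing} {j : T.Crossing} (hp : IsPair s s' j)
    {l : s'.diagram.Loop} {z : T.Node} (hz : Around j z) (hzl : s'.cls z = l.1) :
    s'.maxLayer l ≠ j.1.1 + 1 := by
  intro hl
  have hlow (y : T.Node) (hy : s'.cls y = l.1) : y.1.1 ≤ j.1.1 := by
    have := height_lt_maxLayer l y hy
    omega
  have : j.1.1 + 1 ≤ j.1.1 := by
    rcases hz with rfl | rfl | rfl | rfl
    · exact hlow j.tl ((cls_eq_of_joined hp.joined_left).symm.trans hzl)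
    · exact hlow j.tr ((cls_eq_of_joined hp.joined_right).symm.trans hzl)
    · exact hlow _ hzl
    · exact hlow _ hzl
  omega

theorem isKey_of_u_eq {j : T.Crossing} (hj : a.smoothing.Changes b.smoothing j)
    (hu : Cell.u a b = j.1.1 + 1) : IsKey a b j := by
  -- The infimum over no loops would be 0, but layers are counted from 1. So the minimum is attained
  -- by an actual loop.
  have hne := Nat.nonempty_of_pos_sInf (lt_of_lt_of_eq (Nat.succ_pos _) hu.symm)
  have hmem := Nat.sInf_mem hne
  change Cell.u a b ∈ _ at hmem
  rw [hu] at hmem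
  rcases j.2 with hjl | hjl
  · have hp := hj.isPair_of_pos hjl
    rcases hmem with ⟨l, hr, hl, hm⟩ | ⟨l, hr, hl, hm⟩
    · obtain ⟨z, hz, hzl⟩ := exists_around_of_merged hj hl
      exact absurd hm.symm (maxLayer_ne_of_vert hp hz hzl)
    · obtain ⟨z, hz, hzl⟩ := exists_around_of_splitOut hj hl
      obtain ⟨h1, h2⟩ := lowLoop_of_maxLayer hp hz hzl hm.symm
      exact Or.inr ⟨hjl, hp, h1, mt (redAt_iff_mem l h2.symm).1 hr⟩
  · have hp := hj.isPair_of_neg hjl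
    rcases hmem with ⟨l, hr, hl, hm⟩ | ⟨l, hr, hl, hm⟩
    · obtain ⟨z, hz, hzl⟩ := exists_around_of_merged hj hl
      obtain ⟨h1, h2⟩ := lowLoop_of_maxLayer hp hz hzl hm.symm
      exact Or.inl ⟨hjl, hp, h1, (redAt_iff_mem l h2.symm).2 hr⟩
    · obtain ⟨z, hz, hzl⟩ := exists_around_of_splitOut hj hl
      exact absurd hm.symm (maxLayer_ne_of_vert hp hz hzl)

end Cell
end MorsePresentation
end TangleMorse

/-! ### Adjacency of edges and potentials on closed walks -/

namespace TangleMorse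

theorem Adjacent.symm {V : Type*} {e f : V × V} (h : Adjacent e f) : Adjacent f e := by
  rcases h with h | h | h | h
  · exact Or.inl h.symm
  · exact Or.inr (Or.inr (Or.inl h.symm))
  · exact Or.inr (Or.inl h.symm)
  · exact Or.inr (Or.inr (Or.inr h.symm))

/-- If a potential does not decrease along the steps of closed walks, and increases along the steps
outside `r'`, then closed walks consist of steps in `r'`. -/
theorem transGen_of_potential {α : Type*} {r r' : α → α → Prop} (φ : α → ℕ)
    (h : ∀ x y, r x y → Relation.ReflTransGen r y x → φ x < φ y ∨ (φ x = φ y ∧ r' x y)) {a : α}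
    (ha : Relation.TransGen r a a) : Relation.TransGen r' a a := by
  -- The return walk from `b` to `a` is carried along because `h` only speaks of steps that lie on
  -- closed walks.
  have key : ∀ b, Relation.TransGen r a b → Relation.ReflTransGen r b a →
      φ a < φ b ∨ (φ a = φ b ∧ Relation.TransGen r' a b) := by
    intro b hab
    induction hab with
    | single hs =>
      intro hb
      exact (h _ _ hs hb).imp_right fun h => ⟨h.1, .single h.2⟩
    | tail hab hs ih =>
      intro hb
      rcases ih (.head hs hb) with h1 | ⟨h1, h1'⟩ <;>
        rcases h _ _ hs (hb.trans hab.to_reflTransGen) with h2 | ⟨h2, h2'⟩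
      · exact Or.inl (h1.trans h2)
      · exact Or.inl (h2 ▸ h1)
      · exact Or.inl (h1 ▸ h2)
      · exact Or.inr ⟨h1.trans h2, h1'.tail h2'⟩
  rcases key a ha .refl with h | h
  · exact absurd h (lt_irrefl _)
  · exact h.2

namespace MorsePresentation

open Smoothing

variable {T : MorsePresentation}

/-! ## The lexicographic matching -/

namespace Cell

variable {a b : T.Cell}

/-- A cell is determined by its smoothing and its set of red nodes, both taken from finite sets. -/
instance finite : Finite T.Cell :=
  Finite.of_injective (fun a : T.Cell => (a.smoothing, {x | a.RedAt x})) fun _ _ h =>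
    ext_of_redAt (congrArg Prod.fst h) fun x => iff_of_eq (congrArg (x ∈ Prod.snd ·) h)

/-- In the vertical smoothing the nodes of the low loop have the colour of `j.tl`, so the colours of
`h` off the low loop determine the cell. -/
theorem eq_of_isPair_vert {h v v' : T.Cell} {j : T.Crossing} (hv : v.smoothing = v'.smoothing)
    (hp : IsPair h.smoothing v.smoothing j) (hl : h.smoothing.LowLoop j)
    (h1 : ∀ x, h.smoothing.cls x ≠ h.smoothing.cls j.bl → (h.RedAt x ↔ v.RedAt x))
    (h2 : ∀ x, h.smoothing.cls x ≠ h.smoothing.cls j.bl → (h.RedAt x ↔ v'.RedAt x)) : v = v' := by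
  refine ext_of_redAt hv fun x => ?_
  by_cases hx : h.smoothing.cls x = h.smoothing.cls j.bl
  · rw [redAt_congr (hp.cls_of_mem_loop hl hx), ← h1 _ hl.cls_tl_ne, h2 _ hl.cls_tl_ne,
      redAt_congr (x := x) (y := j.tl) (hv ▸ hp.cls_of_mem_loop hl hx)]
  · rw [← h1 x hx, h2 x hx]

theorem eq_of_isPair_horiz {h h' v : T.Cell} {j : T.Crossing} (hh : h.smoothing = h'.smoothing)
    (h1 : ∀ x, h.smoothing.cls x ≠ h.smoothing.cls j.bl → (h.RedAt x ↔ v.RedAt x))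
    (h2 : ∀ x, h'.smoothing.cls x ≠ h'.smoothing.cls j.bl → (h'.RedAt x ↔ v.RedAt x))
    (hbl : h.RedAt j.bl ↔ h'.RedAt j.bl) : h = h' := by
  refine ext_of_redAt hh fun x => ?_
  by_cases hx : h.smoothing.cls x = h.smoothing.cls j.bl
  · rw [redAt_congr hx, hbl, redAt_congr (x := x) (y := j.bl) (hh ▸ hx)]
  · rw [h1 x hx, h2 x (hh ▸ hx)]

theorem changes_eq_right {s s' s'' : T.Smoothing} {j : T.Crossing} (h : s.Changes s' j)
    (h' : s.Changes s'' j) : s' = s'' := by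
  funext k
  by_cases hk : k = j
  · rw [hk, h.2.1, h'.2.1]
  · rw [h.2.2 k hk, h'.2.2 k hk]

theorem changes_eq_left {s s' s'' : T.Smoothing} {j : T.Crossing} (h : s'.Changes s j)
    (h' : s''.Changes s j) : s' = s'' := by
  funext k
  by_cases hk : k = j
  · rw [hk, h.1, h'.1]
  · rw [← h.2.2 k hk, h'.2.2 k hk]

/-- The end of a key edge is determined by its beginning. -/
theorem IsKey.eq_right {b' : T.Cell} {j : T.Crossing} (hk : IsKey a b j) (hk' : IsKey a b' j)
    (hj : a.smoothing.Changes b.smoothing j) (hj' : a.smoothing.Changes b'.smoothing j)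
    (h : Cell.d a b ∉ Mor.rel a.obj b.obj) (h' : Cell.d a b' ∉ Mor.rel a.obj b'.obj) : b = b' := by
  have hr := hk.redAt_iff h
  have hr' := hk'.redAt_iff h'
  have hs := changes_eq_right hj hj'
  rcases hk with ⟨hjl, hp, hl, hbl⟩ | ⟨hjl, hp, hl, hbl⟩
  · exact eq_of_isPair_vert hs hp hl (hr.1 hjl) (hr'.1 hjl)
  · rcases hk' with ⟨hjl', -⟩ | ⟨-, -, -, hbl'⟩
    · simp [hjl] at hjl'
    · exact eq_of_isPair_horiz hs (fun x hx => (hr.2 hjl x hx).symm)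
        (fun x hx => (hr'.2 hjl x hx).symm) (by simp [hbl, hbl'])

/-- The beginning of a key edge is determined by its end. -/
theorem IsKey.eq_left {a' : T.Cell} {j : T.Crossing} (hk : IsKey a b j) (hk' : IsKey a' b j)
    (hj : a.smoothing.Changes b.smoothing j) (hj' : a'.smoothing.Changes b.smoothing j)
    (h : Cell.d a b ∉ Mor.rel a.obj b.obj) (h' : Cell.d a' b ∉ Mor.rel a'.obj b.obj) : a = a' := by
  have hr := hk.redAt_iff h
  have hr' := hk'.redAt_iff h'
  have hs := changes_eq_left hj hj'
  rcases hk with ⟨hjl, hp, hl, hbl⟩ | ⟨hjl, hp, hl, hbl⟩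
  · rcases hk' with ⟨-, -, -, hbl'⟩ | ⟨hjl', -⟩
    · exact eq_of_isPair_horiz hs (hr.1 hjl) (hr'.1 hjl) (by simp [hbl, hbl'])
    · simp [hjl] at hjl'
  · exact eq_of_isPair_vert hs hp hl (fun x hx => (hr.2 hjl x hx).symm)
      (fun x hx => (hr'.2 hjl x hx).symm)

end Cell

open Cell

variable {o : T.Orientation} {a b : T.Cell}

theorem mem_N_iff {e : T.Cell × T.Cell} {j : ℕ} :
    e ∈ N o j ↔ e ∈ A o j j ∧ ∀ l, 1 ≤ l → l < j → ∀ f ∈ N o l, ¬ Adjacent e f := by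
  rw [N]
  exact Iff.rfl

theorem isKey_of_mem_A {e : T.Cell × T.Cell} {k : ℕ} (h : e ∈ A o k k) :
    ∃ j : T.Crossing, k = j.1.1 + 1 ∧ e.1.smoothing.Changes e.2.smoothing j ∧ IsKey e.1 e.2 j ∧
      Cell.d e.1 e.2 ∉ Mor.rel e.1.obj e.2.obj := by
  obtain ⟨⟨-, hd⟩, -, hi, hu⟩ := h
  obtain ⟨j, hj⟩ := exists_changes hd
  rw [i_eq hj] at hi
  exact ⟨j, hi.symm, hj, isKey_of_u_eq hj (hu.trans hi.symm), hd⟩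

theorem mem_A_of_isKey {j : T.Crossing} (hadj : (graph o).Adj a b)
    (hj : a.smoothing.Changes b.smoothing j) (hk : IsKey a b j) :
    (a, b) ∈ A o (j.1.1 + 1) (j.1.1 + 1) :=
  ⟨hadj, hk.isIso hadj.2 hj o, i_eq hj, hk.u_eq hj⟩

/-- Both edges change the same crossing, so the end of one cannot be the beginning of the other: the
crossing would be smoothed in both ways. A common beginning or end determines a key edge. -/
theorem eq_of_adjacent_of_mem_A {e f : T.Cell × T.Cell} {k : ℕ} (he : e ∈ A o k k)
    (hf : f ∈ A o k k) (hef : Adjacent e f) : e = f := by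
  obtain ⟨j, hj, hc, hkey, hd⟩ := isKey_of_mem_A he
  obtain ⟨j', hj', hc', hkey', hd'⟩ := isKey_of_mem_A hf
  obtain rfl : j' = j := Subtype.ext (Fin.ext (by omega))
  obtain ⟨a, b⟩ := e
  obtain ⟨a', b'⟩ := f
  rcases hef with h | h | h | h
  · obtain rfl : a = a' := h
    exact congrArg (Prod.mk a) (hkey.eq_right hkey' hc hc' hd hd')
  · obtain rfl : a = b' := h
    exact absurd (hc.1.symm.trans hc'.2.1) zero_ne_one
  · obtain rfl : b = a' := h
    exact absurd (hc'.1.symm.trans hc.2.1) zero_ne_one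
  · obtain rfl : b = b' := h
    exact congrArg (Prod.mk · b) (hkey.eq_left hkey' hc hc' hd hd')

theorem eq_of_adjacent_of_mem_lexMatching {e f : T.Cell × T.Cell} (he : e ∈ lexMatching o)
    (hf : f ∈ lexMatching o) (hef : Adjacent e f) : e = f := by
  obtain ⟨k, hk, he⟩ := he
  obtain ⟨l, hl, hf⟩ := hf
  rw [mem_N_iff] at he hf
  rcases lt_trichotomy k l with h | rfl | h
  · exact absurd hef.symm (hf.2 k hk h e (mem_N_iff.2 he))
  · exact eq_of_adjacent_of_mem_A he.1 hf.1 hef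
  · exact absurd hef (he.2 l hl h f (mem_N_iff.2 hf))

theorem mem_N_of_mem_lexMatching {j : T.Crossing} (h : (a, b) ∈ lexMatching o)
    (hj : a.smoothing.Changes b.smoothing j) : (a, b) ∈ N o (j.1.1 + 1) := by
  obtain ⟨k, -, h⟩ := h
  have hi : Cell.i a b = k := (mem_N_iff.1 h).1.2.2.1
  rw [i_eq hj] at hi
  exact hi ▸ h

theorem adj_of_mem_lexMatching {e : T.Cell × T.Cell} (h : e ∈ lexMatching o) :
    (graph o).Adj e.1 e.2 := by
  obtain ⟨k, -, h⟩ := h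
  exact (mem_N_iff.1 h).1.1

/-! ### Acyclicity -/

/-- A step in the graph with the edges of the matching reversed, which changes a crossing in a layer
above the lowest `k` layers. -/
def Step (o : T.Orientation) (k : ℕ) (a b : T.Cell) : Prop :=
  (∃ j : T.Crossing, k ≤ j.1.1 ∧ a.smoothing.Changes b.smoothing j ∧ (graph o).Adj a b ∧
      (a, b) ∉ lexMatching o) ∨
    ∃ j : T.Crossing, k ≤ j.1.1 ∧ b.smoothing.Changes a.smoothing j ∧ (b, a) ∈ lexMatching o

theorem step_of_reverseEdges (h : (reverseEdges (graph o) (lexMatching o)).Adj a b) :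
    Step o 0 a b := by
  rcases h with ⟨h, hM⟩ | hM
  · obtain ⟨j, hj⟩ := exists_changes h.2
    exact Or.inl ⟨j, Nat.zero_le _, hj, h, hM⟩
  · obtain ⟨j, hj⟩ := exists_changes (adj_of_mem_lexMatching hM).2
    exact Or.inr ⟨j, Nat.zero_le _, hj, hM⟩

/-- A walk lowers the homological degree by at most one, and if it does, it ends with the reverse
of an edge of the matching. -/
theorem homDegree_of_reflTransGen {k : ℕ} (h : Relation.ReflTransGen (Step o k) a b) :
    a.homDegree o ≤ b.homDegree o ∨ (b.homDegree o = a.homDegree o - 1 ∧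
      ∃ (c : T.Cell) (j : T.Crossing), k ≤ j.1.1 ∧ b.smoothing.Changes c.smoothing j ∧
        (b, c) ∈ lexMatching o) := by
  induction h with
  | refl => exact Or.inl le_rfl
  | @tail b c _ hs ih =>
    rcases hs with ⟨j, hk, hj, hadj, hM⟩ | ⟨j, hk, hj, hM⟩
    · have := hadj.1
      left
      rcases ih with ih | ⟨ih, -⟩ <;> omega
    · have hdeg : b.homDegree o = c.homDegree o + 1 := (adj_of_mem_lexMatching hM).1
      rcases ih with ih | ⟨-, c', j', -, -, hM'⟩
      · by_cases hc : a.homDegree o ≤ c.homDegree o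
        · exact Or.inl hc
        · exact Or.inr ⟨by omega, b, j, hk, hj, hM⟩
      -- Two successive reversed edges would meet at `b` and hence coincide, although `b` is the end
      -- of one and the beginning of the other.
      · have := eq_of_adjacent_of_mem_lexMatching hM hM' (Or.inr (Or.inr (Or.inl rfl)))
        have h1 : c = b := congrArg Prod.fst this
        rw [h1] at hdeg
        omega

/-- In a closed walk, the ends of an edge which is not reversed are matched, in layers that occur
in the walk. -/
theorem matched_of_closed {k : ℕ} (hadj : (graph o).Adj a b)
    (h : Relation.ReflTransGen (Step o k) b a) :
    (∃ (c : T.Cell) (j : T.Crossing), k ≤ j.1.1 ∧ a.smoothing.Changes c.smoothing j ∧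
        (a, c) ∈ lexMatching o) ∧
      ∃ (c : T.Cell) (j : T.Crossing), k ≤ j.1.1 ∧ c.smoothing.Changes b.smoothing j ∧
        (c, b) ∈ lexMatching o := by
  have hdeg := hadj.1
  constructor
  -- The walk back from `b` to `a` lowers the degree by one, so it ends with a reversed edge of the
  -- matching beginning at `a`.
  · rcases homDegree_of_reflTransGen h with h | h
    · omega
    · exact h.2
  -- If the walk back began with a forward edge, the rest of it would have to lower the degree by
  -- two.
  · rcases Relation.ReflTransGen.cases_head h with h | ⟨c, hs, hc⟩
    · rw [h] at hdeg
      omega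
    · rcases hs with ⟨j, hk, hj, hadj', -⟩ | ⟨j, hk, hj, hM⟩
      · have := hadj'.1
        rcases homDegree_of_reflTransGen hc with h | h <;> omega
      · exact ⟨c, j, hk, hj, hM⟩

/-- A key edge in the lowest layer of a closed walk belongs to the matching. -/
theorem mem_lexMatching_of_closed {j : T.Crossing} (hadj : (graph o).Adj a b)
    (hj : a.smoothing.Changes b.smoothing j) (hk : IsKey a b j)
    (h : Relation.ReflTransGen (Step o j.1.1) b a) : (a, b) ∈ lexMatching o := by
  refine ⟨j.1.1 + 1, Nat.le_add_left 1 _, mem_N_iff.2 ⟨mem_A_of_isKey hadj hj hk, ?_⟩⟩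
  intro l hl hlj f hf hef
  have hfM : f ∈ lexMatching o := ⟨l, hl, hf⟩
  have hfi : Cell.i f.1 f.2 = l := (mem_N_iff.1 hf).1.2.2.1
  -- The ends are matched in layers no lower than that of `j`. A competing edge `f` must be one of
  -- these two partners, which contradicts its lower layer number `l`.
  obtain ⟨⟨c, j1, hj1, hc1, hM1⟩, ⟨c', j2, hj2, hc2, hM2⟩⟩ := matched_of_closed hadj h
  rcases hef with h1 | h1 | h1 | h1
  · rw [← eq_of_adjacent_of_mem_lexMatching hM1 hfM (Or.inl h1), i_eq hc1] at hfi
    omega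
  · rw [← eq_of_adjacent_of_mem_lexMatching hM1 hfM (Or.inr (Or.inl h1)), i_eq hc1] at hfi
    omega
  · rw [← eq_of_adjacent_of_mem_lexMatching hM2 hfM (Or.inr (Or.inr (Or.inl h1))), i_eq hc2] at hfi
    omega
  · rw [← eq_of_adjacent_of_mem_lexMatching hM2 hfM (Or.inr (Or.inr (Or.inr h1))), i_eq hc2] at hfi
    omega

open Classical in
/-- A potential which increases along the steps of closed walks in the layer of `j`, if the walk
does not meet lower layers. -/
noncomputable def potential (j : T.Crossing) (a : T.Cell) : ℕ :=
  if a.smoothing.flat j.1 = .vert then 1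
  else if T.layer j.1 = .neg then (if a.smoothing.LowLoop j ∧ a.RedAt j.bl then 2 else 0)
  else if a.smoothing.LowLoop j ∧ ¬ a.RedAt j.bl then 0 else 2

/-- The nodes around a higher crossing all lie above the greatest height that the low loop can
reach. -/
theorem avoids_of_lowLoop {s : T.Smoothing} {j j' : T.Crossing} (hl : s.LowLoop j)
    (hjj : j.1.1 < j'.1.1) : s.Avoids j' j.bl := by
  intro z hz e
  have h1 := hl.2 z e
  rcases hz.height with h | h <;> have h2 := congrArg Fin.val h <;>
    simp only [Fin.val_castSucc, Fin.val_succ] at h2 <;> omega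

theorem lowLoop_of_agreeOff {s s' : T.Smoothing} {j j' : T.Crossing} (h : AgreeOff s s' j')
    (h' : AgreeOff s' s j') (hl : s.LowLoop j) (hjj : j.1.1 < j'.1.1) : s'.LowLoop j := by
  have hav := avoids_of_lowLoop hl hjj
  exact ⟨mt (hav.isArc_iff h h').1 hl.1, fun z hz => hl.2 z ((hav.cls_eq_iff h h').1 hz)⟩

/-- Changes in higher layers do not affect the potential. -/
theorem potential_eq {j j' : T.Crossing} (hjj : j.1.1 < j'.1.1)
    (hj : a.smoothing.Changes b.smoothing j') (h : Cell.d a b ∉ Mor.rel a.obj b.obj) :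
    potential j a = potential j b := by
  have hflat := hj.flat_eq j.1 (fun e => by rw [e] at hjj; omega)
  have hlow : a.smoothing.LowLoop j ↔ b.smoothing.LowLoop j :=
    ⟨fun hl => lowLoop_of_agreeOff hj.agreeOff.1 hj.agreeOff.2 hl hjj,
      fun hl => lowLoop_of_agreeOff hj.agreeOff.2 hj.agreeOff.1 hl hjj⟩
  have hred (hl : a.smoothing.LowLoop j) : a.RedAt j.bl ↔ b.RedAt j.bl :=
    redAt_iff_of_avoids h hj (avoids_of_lowLoop hl hjj)
  have h1 : a.smoothing.LowLoop j ∧ a.RedAt j.bl ↔ b.smoothing.LowLoop j ∧ b.RedAt j.bl := by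
    rw [← hlow]
    exact and_congr_right hred
  have h2 : a.smoothing.LowLoop j ∧ ¬ a.RedAt j.bl ↔ b.smoothing.LowLoop j ∧ ¬ b.RedAt j.bl := by
    rw [← hlow]
    exact and_congr_right fun hl => not_congr (hred hl)
  classical
  rw [potential, potential, hflat]
  exact if_congr Iff.rfl rfl (if_congr Iff.rfl (if_congr h1 rfl rfl) (if_congr h2 rfl rfl))

theorem potential_of_vert {s : T.Smoothing} {j : T.Crossing} (h : IsPair s a.smoothing j) :
    potential j a = 1 := if_pos h.vert

theorem potential_of_neg {s : T.Smoothing} {j : T.Crossing} (h : IsPair a.smoothing s j)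
    (hj : T.layer j.1 = .neg) [Decidable (a.smoothing.LowLoop j ∧ a.RedAt j.bl)] :
    potential j a = if a.smoothing.LowLoop j ∧ a.RedAt j.bl then 2 else 0 := by
  rw [potential, if_neg (by simp [h.horiz]), if_pos hj]
  congr

theorem potential_of_pos {s : T.Smoothing} {j : T.Crossing} (h : IsPair a.smoothing s j)
    (hj : T.layer j.1 = .pos) [Decidable (a.smoothing.LowLoop j ∧ ¬ a.RedAt j.bl)] :
    potential j a = if a.smoothing.LowLoop j ∧ ¬ a.RedAt j.bl then 0 else 2 := by
  rw [potential, if_neg (by simp [h.horiz]), if_neg (by simp [hj])]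
  congr

theorem potential_lt_of_isKey {j : T.Crossing} (hk : IsKey a b j) :
    potential j b < potential j a := by
  classical
  rcases hk with ⟨hj, hp, hl, hr⟩ | ⟨hj, hp, hl, hr⟩
  · rw [potential_of_vert hp, potential_of_neg hp hj, if_pos ⟨hl, hr⟩]
    exact one_lt_two
  · rw [potential_of_vert hp, potential_of_pos hp hj, if_pos ⟨hl, hr⟩]
    exact one_pos

/-- A non-key edge takes the potential from 0 to 1 at a `neg` crossing and from 1 to 2 at a `pos`
crossing. Key edges take it from 2 to 1 and from 1 to 0 respectively, so their reversals increase it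
too. -/
theorem potential_lt_of_not_isKey {j : T.Crossing} (hj : a.smoothing.Changes b.smoothing j)
    (hk : ¬ IsKey a b j) : potential j a < potential j b := by
  classical
  rcases j.2 with hjl | hjl
  · have hp := hj.isPair_of_pos hjl
    rw [potential_of_vert hp, potential_of_pos hp hjl,
      if_neg fun h => hk (Or.inr ⟨hjl, hp, h.1, h.2⟩)]
    exact one_lt_two
  · have hp := hj.isPair_of_neg hjl
    rw [potential_of_vert hp, potential_of_neg hp hjl,
      if_neg fun h => hk (Or.inl ⟨hjl, hp, h.1, h.2⟩)]
    exact one_pos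

/-- A closed walk above the lowest `k` layers does not meet layer `k`. -/
theorem transGen_step_succ {k : ℕ} (h : Relation.TransGen (Step o k) a a) :
    Relation.TransGen (Step o (k + 1)) a a := by
  by_cases hk : ∃ j : T.Crossing, j.1.1 = k
  · obtain ⟨j, rfl⟩ := hk
    refine transGen_of_potential (potential j) (fun x y hxy hyx => ?_) h
    rcases hxy with ⟨j', hjj, hj, hadj, hM⟩ | ⟨j', hjj, hj, hM⟩
    · rcases hjj.lt_or_eq with hlt | heq
      · exact Or.inr ⟨potential_eq hlt hj hadj.2, Or.inl ⟨j', hlt, hj, hadj, hM⟩⟩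
      · obtain rfl : j = j' := Subtype.ext (Fin.ext heq)
        -- A forward key edge in the lowest layer of the closed walk would lie in the matching and
        -- would then have been reversed.
        exact Or.inl (potential_lt_of_not_isKey hj
          fun hkey => hM (mem_lexMatching_of_closed hadj hj hkey hyx))
    · have hd := (adj_of_mem_lexMatching hM).2
      rcases hjj.lt_or_eq with hlt | heq
      · exact Or.inr ⟨(potential_eq hlt hj hd).symm, Or.inr ⟨j', hlt, hj, hM⟩⟩
      · obtain rfl : j = j' := Subtype.ext (Fin.ext heq)
        have hA := (mem_N_iff.1 (mem_N_of_mem_lexMatching hM hj)).1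
        exact Or.inl (potential_lt_of_isKey (isKey_of_u_eq hj hA.2.2.2))
  · refine Relation.TransGen.mono (fun x y hxy => ?_) _ _ h
    rcases hxy with ⟨j', hjj, h⟩ | ⟨j', hjj, h⟩
    · exact Or.inl ⟨j', lt_of_le_of_ne hjj fun e => hk ⟨j', e.symm⟩, h⟩
    · exact Or.inr ⟨j', lt_of_le_of_ne hjj fun e => hk ⟨j', e.symm⟩, h⟩

theorem not_transGen_step_zero : ¬ Relation.TransGen (Step o 0) a a := by
  intro h
  have hk (k : ℕ) : Relation.TransGen (Step o k) a a := by
    induction k with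
    | zero => exact h
    | succ k ih => exact transGen_step_succ ih
  -- For `k = T.len` no layer is left, yet the closed walk has a last step.
  obtain ⟨b, -, hs⟩ := Relation.TransGen.tail'_iff.1 (hk T.len)
  rcases hs with ⟨j, hj, -⟩ | ⟨j, hj, -⟩ <;> exact absurd j.1.2 (not_lt.2 hj)

end MorsePresentation
end TangleMorse

theorem mainTheorem6 (T : TangleMorse.MorsePresentation) (o : T.Orientation) :
    TangleMorse.IsMorseMatching (TangleMorse.MorsePresentation.graph o)
      (TangleMorse.MorsePresentation.Cell.IsIso o)
      (TangleMorse.MorsePresentation.lexMatching o) where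
  edges _ he := TangleMorse.MorsePresentation.adj_of_mem_lexMatching he
  finite := Set.toFinite _
  matching _ he _ hf hne hadj :=
    hne (TangleMorse.MorsePresentation.eq_of_adjacent_of_mem_lexMatching he hf hadj)
  isIso e he := by
    obtain ⟨k, -, he⟩ := he
    exact (TangleMorse.MorsePresentation.mem_N_iff.1 he).1.2.1
  acyclic a h := TangleMorse.MorsePresentation.not_transGen_step_zero
    (Relation.TransGen.mono (fun _ _ => TangleMorse.MorsePresentation.step_of_reverseEdges) _ _ h)
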